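/- Let $d\ge 0$. Normalize the Fourier transform on the Schwartz space $\mathcal S(\mathbb R^d)$ by $(\mathcal F\varphi)(\lambda)=(2\pi)^{-d/2}\int_{\mathbb R^d}\varphi(x)e^{-i\lambda\cdot x}\,dx$, and extend it to tempered distributions by $\langle\mathcal F T,\varphi\rangle=\langle T,\mathcal F\varphi\rangle$. A function $f:\mathbb R^d\to\mathbb C$ is said to be the Fourier transform of a tempered distribution $T$ if $f$ is continuous, $f\varphi$ is integrable for every $\varphi\in\mathcal S(\mathbb R^d)$, and $\langle \mathcal F T,\varphi\rangle=\int f\varphi\,dx$ for all such $\varphi$; we then write $T=\mathcal F^{-1}f$. The order of a distribution $T$ is the least $N\in\mathbb N_0$ (if any) such that for every compact $K\subset\mathbb R^d$ there is a constant $C$ with $|\langle T,\varphi\rangle|\le C\sum_{k\le N}\sup_{x}\|D^k\varphi(x)\|$ for all smooth $\varphi$ supported in $K$. For a nonempty compact set $A\subset\mathbb R^d$ put $H_A(y)=\max_{a\in A}a\cdot y$ for $y\in\mathbb R^d$. Theorem. Let $A$ be a nonempty compact convex subset of $\mathbb R^d$ that is symmetric ($-A=A$), and let $f:\mathbb R^d\to\mathbb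 C$. Then the following are equivalent: (a) $f$ is the Fourier transform of a (necessarily tempered) distribution with support contained in $A$; (b) $f$ extends to an entire function on $\mathbb C^d$, and there exist an integer $N\in\mathbb N_0$ and a constant $C$ such that $|f(z)|\le C(1+|z|)^N e^{H_A(\operatorname{Im} z)}$ for all $z\in\mathbb C^d$. If this is the case, then the distribution $\mathcal F^{-1}f$ has finite order, and the integer $N$ in (b) can be taken to be the order of $\mathcal F^{-1}f$. -/

import Mathlib

open scoped SchwartzMap FourierTransform RealInnerProductSpace
open MeasureTheory

namespace ComplexPaleyWiener

/-- The Fourier transform on Schwartz functions on `ℝ^d`, normalized as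
`(ℱ φ)(ξ) = (2π)^{-d/2} ∫ φ(x) e^{-i ξ·x} dx` (see `fourierSchwartz_apply`). It is obtained from
Mathlib's Fourier transform, whose kernel is `e^{-2πi ξ·x}`, by rescaling. -/
noncomputable def fourierSchwartz (d : ℕ) :
    𝓢(EuclideanSpace ℝ (Fin d), ℂ) →L[ℂ] 𝓢(EuclideanSpace ℝ (Fin d), ℂ) :=
  ((((2 * Real.pi) ^ ((d : ℝ) / 2))⁻¹ : ℝ) : ℂ) •
    ((SchwartzMap.compCLMOfContinuousLinearEquiv ℂ
      (ContinuousLinearEquiv.smulLeft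
        (Units.mk0 ((2 * Real.pi)⁻¹ : ℝ) (inv_ne_zero Real.two_pi_pos.ne')))).comp
      (FourierTransform.fourierCLM ℂ 𝓢(EuclideanSpace ℝ (Fin d), ℂ)))

theorem fourierSchwartz_apply (d : ℕ) (φ : 𝓢(EuclideanSpace ℝ (Fin d), ℂ))
    (ξ : EuclideanSpace ℝ (Fin d)) :
    fourierSchwartz d φ ξ =
      ((((2 * Real.pi) ^ ((d : ℝ) / 2))⁻¹ : ℝ) : ℂ) *
        ∫ x : EuclideanSpace ℝ (Fin d), φ x * Complex.exp (-Complex.I * (⟪ξ, x⟫ : ℝ)) := by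
  have h : fourierSchwartz d φ ξ = ((((2 * Real.pi) ^ ((d : ℝ) / 2))⁻¹ : ℝ) : ℂ) *
      (𝓕 (φ : EuclideanSpace ℝ (Fin d) → ℂ)) ((2 * Real.pi)⁻¹ • ξ) := rfl
  rw [h, Real.fourier_eq']
  congr 1
  refine integral_congr_ae (Filter.Eventually.of_forall fun x => ?_)
  have hpi : (2 * Real.pi) ≠ 0 := Real.two_pi_pos.ne'
  have e : -2 * Real.pi * ⟪x, (2 * Real.pi)⁻¹ • ξ⟫ = -⟪ξ, x⟫ := by
    rw [inner_smul_right, real_inner_comm]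
    field_simp
  simp only [e, smul_eq_mul]
  rw [mul_comm]
  congr 2
  push_cast
  ring

/-- The Fourier transform of a tempered distribution, `⟨ℱ T, φ⟩ = ⟨T, ℱ φ⟩`. -/
noncomputable def fourierTempered (d : ℕ) :
    𝓢'(EuclideanSpace ℝ (Fin d), ℂ) →L[ℂ] 𝓢'(EuclideanSpace ℝ (Fin d), ℂ) :=
  PointwiseConvergenceCLM.precomp ℂ (fourierSchwartz d)

theorem fourierTempered_apply (d : ℕ) (T : 𝓢'(EuclideanSpace ℝ (Fin d), ℂ))
    (φ : 𝓢(EuclideanSpace ℝ (Fin d), ℂ)) :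
    fourierTempered d T φ = T (fourierSchwartz d φ) := rfl

/-- The function `f` is the Fourier transform of the tempered distribution `T`: `f` is the
continuous function representing `ℱ T`. (Without continuity, `f` would be determined only up to
modification on a null set.) -/
def IsFourierTransformOf {d : ℕ} (f : EuclideanSpace ℝ (Fin d) → ℂ)
    (T : 𝓢'(EuclideanSpace ℝ (Fin d), ℂ)) : Prop :=
  Continuous f ∧
    ∀ φ : 𝓢(EuclideanSpace ℝ (Fin d), ℂ),
      Integrable (fun x => f x * φ x) ∧ fourierTempered d T φ = ∫ x, f x * φ x

/-- `T` has order at most `N`: for every compact `K` there is `C` such that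
`|⟨T, φ⟩| ≤ C ∑_{k ≤ N} sup_x ‖D^k φ(x)‖` for all smooth `φ` supported in `K`.
(`SchwartzMap.seminorm ℂ 0 k φ` is `sup_x ‖D^k φ(x)‖`, and a Schwartz function with support in a
compact set is the same thing as a smooth function with support in that set.) -/
def HasOrderAtMost {d : ℕ} (T : 𝓢'(EuclideanSpace ℝ (Fin d), ℂ)) (N : ℕ) : Prop :=
  ∀ K : Set (EuclideanSpace ℝ (Fin d)), IsCompact K → ∃ C : ℝ,
    ∀ φ : 𝓢(EuclideanSpace ℝ (Fin d), ℂ), tsupport φ ⊆ K →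
      ‖T φ‖ ≤ C * ∑ k ∈ Finset.range (N + 1), SchwartzMap.seminorm ℂ 0 k φ

/-- `N` is the order of `T`: the least `N` such that `T` has order at most `N`. -/
def HasOrder {d : ℕ} (T : 𝓢'(EuclideanSpace ℝ (Fin d), ℂ)) (N : ℕ) : Prop :=
  IsLeast {n : ℕ | HasOrderAtMost T n} N

/-- The supporting function `H_A(x) = max_{a ∈ A} a·x`
(the supremum is a maximum for nonempty compact `A`). -/
noncomputable def supportingFunction {d : ℕ} (A : Set (EuclideanSpace ℝ (Fin d)))
    (x : EuclideanSpace ℝ (Fin d)) : ℝ :=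
  sSup ((fun a => ⟪a, x⟫) '' A)

/-- The inclusion `ℝ^d ⊆ ℂ^d`. -/
noncomputable def realToComplex {d : ℕ} (x : EuclideanSpace ℝ (Fin d)) :
    EuclideanSpace ℂ (Fin d) :=
  WithLp.toLp 2 fun j => (x j : ℂ)

/-- The imaginary part `Im z ∈ ℝ^d` of `z ∈ ℂ^d`. -/
noncomputable def imPart {d : ℕ} (z : EuclideanSpace ℂ (Fin d)) : EuclideanSpace ℝ (Fin d) :=
  WithLp.toLp 2 fun j => (z j).im

/-- `f` extends to an entire function `F` on `ℂ^d` such that, for some constant `C`,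
`|F(z)| ≤ C (1 + |z|)^N e^{H_A(Im z)}` for all `z ∈ ℂ^d`. -/
def ExtendsEntireWithBound {d : ℕ} (A : Set (EuclideanSpace ℝ (Fin d)))
    (f : EuclideanSpace ℝ (Fin d) → ℂ) (N : ℕ) : Prop :=
  ∃ F : EuclideanSpace ℂ (Fin d) → ℂ,
    Differentiable ℂ F ∧ (∀ x, F (realToComplex x) = f x) ∧
      ∃ C : ℝ, ∀ z, ‖F z‖ ≤ C * (1 + ‖z‖) ^ N * Real.exp (supportingFunction A (imPart z))

end ComplexPaleyWiener

/-! From (a) to (b). If T is supported in A, then f(ξ) = (2π)^{-d/2} T(χ e^{-iξ·x}) for every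
compactly supported smooth χ equal to 1 near A; this is seen by testing ℱT against a bump shrinking
to ξ (`IsFourierTransformOf.eq_apply_exp`). Putting a complex z in place of ξ gives an entire
function (`differentiable_apply_exp`). The sharp bound comes from letting the cutoff depend on z: T
does not see changes of χ off a neighbourhood of A, so χ may be supported within about δ = 1/(1+|z|)
of A. Each derivative, whether it falls on χ or on the exponential, then costs one factor 1+|z|,
while enlarging A by O(δ) multiplies the exponential by e^{O(δ|Im z|)} = O(1). Hence the power is
the order of T and the exponent is exactly H_A (`HasOrderAtMost.exists_norm_apply_exp_le`). The
order is finite because T is bounded by finitely many Schwartz seminorms.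

From (b) to (a). Since H_A(0) = 0, f grows polynomially on ℝ^d, so φ ↦ ∫ f ℱ⁻¹φ defines T. A point
outside A is separated from A by a hyperplane with normal v; let φ be supported near that point,
beyond the hyperplane. In Tφ = ∫ F ℱ⁻¹φ both factors are entire, so the contour can be moved from
ℝ^d to ℝ^d + itv. There F grows like e^{tH_A(v)} and ℱ⁻¹φ decays like e^{-t(H_A(v)+ε)}, up to
powers, and t → ∞ gives Tφ = 0 (`integral_mul_fourierSchwartzInv_eq_zero`).

The last claim chains the two: (b) puts the support in A, and the first argument then runs with N
the order of T. -/

namespace ComplexPaleyWiener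

/-! ### Derivatives of exponentials of linear forms. -/

section Calculus

open scoped ContDiff

variable {E : Type*} [NormedAddCommGroup E] [NormedSpace ℝ E]

theorem hasFDerivAt_comp_clm {u u' : ℂ → ℂ} (hu : ∀ w, HasDerivAt u (u' w) w) (l : E →L[ℝ] ℂ)
    (x : E) : HasFDerivAt (fun x => u (l x))
      (((ContinuousLinearMap.mul ℝ ℂ).flip.precompR E).flip l (u' (l x))) x := by
  have h := ((hu (l x)).complexToReal_fderiv.comp x l.hasFDerivAt)
  refine h.congr_fderiv ?_
  ext v
  simp

theorem contDiff_exp_clm (l : E →L[ℝ] ℂ) : ContDiff ℝ ∞ fun x => Complex.exp (l x) :=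
  l.contDiff.cexp

/-- By the chain rule each derivative trades u for u' at the cost of one factor ‖l‖. Stating it for
a pair (u, u') lets the same step serve exp, exp - 1 and exp - 1 - id. -/
theorem norm_iteratedFDeriv_succ_comp_clm_le {u u' : ℂ → ℂ} (hu : ∀ w, HasDerivAt u (u' w) w)
    (l : E →L[ℝ] ℂ) (hu' : ContDiff ℝ ∞ fun x => u' (l x)) (n : ℕ) (x : E) :
    ‖iteratedFDeriv ℝ (n + 1) (fun x => u (l x)) x‖ ≤
      ‖l‖ * ‖iteratedFDeriv ℝ n (fun x => u' (l x)) x‖ := by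
  set L : ℂ →L[ℝ] E →L[ℝ] ℂ := ((ContinuousLinearMap.mul ℝ ℂ).flip.precompR E).flip l with hL
  have hLn : ‖L‖ ≤ ‖l‖ := by
    refine L.opNorm_le_bound (norm_nonneg _) fun w => ?_
    refine ContinuousLinearMap.opNorm_le_bound _ (by positivity) fun v => ?_
    have : L w v = l v * w := by simp [hL, mul_comm]
    rw [this, norm_mul]
    calc ‖l v‖ * ‖w‖ ≤ ‖l‖ * ‖v‖ * ‖w‖ := by gcongr; exact l.le_opNorm v
      _ = _ := by ring
  have hf : fderiv ℝ (fun x => u (l x)) = L ∘ fun x => u' (l x) := by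
    ext1 x
    exact (hasFDerivAt_comp_clm hu l x).fderiv
  rw [← norm_iteratedFDeriv_fderiv, hf]
  refine (L.norm_iteratedFDeriv_comp_left (N := ∞) hu'.contDiffAt (mod_cast le_top)).trans ?_
  gcongr

theorem norm_iteratedFDeriv_exp_clm_le (l : E →L[ℝ] ℂ) (n : ℕ) (x : E) :
    ‖iteratedFDeriv ℝ n (fun x => Complex.exp (l x)) x‖ ≤ ‖l‖ ^ n * Real.exp (l x).re := by
  induction n with
  | zero => simp [Complex.norm_exp]
  | succ n ih =>
    refine (norm_iteratedFDeriv_succ_comp_clm_le Complex.hasDerivAt_exp l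
      (contDiff_exp_clm l) n x).trans ?_
    rw [pow_succ', mul_assoc]
    gcongr

/-- The first-order Taylor remainder of `exp ∘ l` and its derivatives are quadratic in `l`. -/
theorem norm_iteratedFDeriv_exp_sub_le {R : ℝ} (hR : 1 ≤ R) (l : E →L[ℝ] ℂ) (hl : ‖l‖ * R ≤ 1)
    (n : ℕ) {x : E} (hx : ‖x‖ ≤ R) :
    ‖iteratedFDeriv ℝ n (fun x => Complex.exp (l x) - 1 - l x) x‖ ≤
      (3 * R ^ 2) * ‖l‖ ^ 2 := by
  have hlx : ‖l x‖ ≤ ‖l‖ * R := (l.le_opNorm x).trans (by gcongr)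
  have hlx1 : ‖l x‖ ≤ 1 := hlx.trans hl
  have hl1 : ‖l‖ ≤ 1 := by nlinarith [norm_nonneg l]
  have hR2 : R ≤ R ^ 2 := by nlinarith
  have h1 : ∀ w, HasDerivAt (fun w => Complex.exp w - 1 - w) (Complex.exp w - 1) w := fun w =>
    ((Complex.hasDerivAt_exp w).sub_const 1).sub (hasDerivAt_id w)
  have h2 : ∀ w, HasDerivAt (fun w => Complex.exp w - 1) (Complex.exp w) w := fun w =>
    (Complex.hasDerivAt_exp w).sub_const 1
  have s1 : ContDiff ℝ ∞ fun x => Complex.exp (l x) - 1 := (contDiff_exp_clm l).sub contDiff_const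
  -- The two factors ‖l‖ arise differently: from the Taylor remainder for n = 0, one from the chain
  -- rule and one from |e^w - 1| for n = 1, both from the chain rule for n ≥ 2.
  rcases n with _ | n
  · simp only [norm_iteratedFDeriv_zero]
    calc _ ≤ ‖l x‖ ^ 2 := Complex.norm_exp_sub_one_sub_id_le hlx1
      _ ≤ (‖l‖ * R) ^ 2 := by gcongr
      _ ≤ _ := by nlinarith [sq_nonneg (‖l‖ * R)]
  refine (norm_iteratedFDeriv_succ_comp_clm_le h1 l s1 n x).trans ?_
  rcases n with _ | n
  · simp only [norm_iteratedFDeriv_zero]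
    calc _ ≤ ‖l‖ * (2 * (‖l‖ * R)) := by
          gcongr
          exact (Complex.norm_exp_sub_one_le hlx1).trans (by gcongr)
      _ = 2 * R * ‖l‖ ^ 2 := by ring
      _ ≤ _ := by gcongr; norm_num
  · calc _ ≤ ‖l‖ * (‖l‖ * (‖l‖ ^ n * Real.exp (l x).re)) := by
          gcongr
          refine (norm_iteratedFDeriv_succ_comp_clm_le h2 l (contDiff_exp_clm l) n x).trans ?_
          gcongr
          exact norm_iteratedFDeriv_exp_clm_le l n x
      _ ≤ ‖l‖ * (‖l‖ * (1 * 3)) := by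
          gcongr
          · exact pow_le_one₀ (norm_nonneg _) hl1
          · calc Real.exp (l x).re ≤ Real.exp 1 := by
                  gcongr
                  exact (Complex.re_le_norm _).trans hlx1
              _ ≤ 3 := by linarith [Real.exp_one_lt_d9]
      _ = 3 * 1 * ‖l‖ ^ 2 := by ring
      _ ≤ _ := by gcongr; nlinarith

end Calculus

/-! ### Schwartz seminorm estimates for products. -/

section Schwartz

open scoped ContDiff

variable {E : Type*} [NormedAddCommGroup E] [NormedSpace ℝ E]

/-- Each Schwartz seminorm of a product `χ h`, with `χ` a fixed Schwartz function, is controlled by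
the first derivatives of `h` on the support of `χ`. -/
theorem exists_seminorm_mul_le (χ : 𝓢(E, ℂ)) (k n : ℕ) :
    ∃ C : ℝ, 0 ≤ C ∧ ∀ (h : E → ℂ) (B : ℝ), ContDiff ℝ ∞ h → 0 ≤ B →
      (∀ x ∈ tsupport χ, ∀ j ≤ n, ‖iteratedFDeriv ℝ j h x‖ ≤ B * (1 + ‖x‖)) →
      ∀ φ : 𝓢(E, ℂ), (∀ x, φ x = χ x * h x) → SchwartzMap.seminorm ℂ k n φ ≤ C * B := by
  refine ⟨∑ i ∈ Finset.range (n + 1), (n.choose i : ℝ) *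
    (SchwartzMap.seminorm ℂ k i χ + SchwartzMap.seminorm ℂ (k + 1) i χ), by positivity, ?_⟩
  intro h B hh hB hbound φ hφ
  refine SchwartzMap.seminorm_le_bound ℂ k n φ (by positivity) fun x => ?_
  have e : (φ : E → ℂ) = fun x => χ x * h x := funext hφ
  rw [e]
  by_cases hx : x ∈ tsupport χ
  · calc _ ≤ ‖x‖ ^ k * ∑ i ∈ Finset.range (n + 1), (n.choose i : ℝ) *
          ‖iteratedFDeriv ℝ i χ x‖ * ‖iteratedFDeriv ℝ (n - i) h x‖ := by
          gcongr
          exact norm_iteratedFDeriv_mul_le (χ.smooth ⊤) hh x (mod_cast le_top)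
      _ ≤ ‖x‖ ^ k * ∑ i ∈ Finset.range (n + 1), (n.choose i : ℝ) *
          ‖iteratedFDeriv ℝ i χ x‖ * (B * (1 + ‖x‖)) := by
          gcongr with i hi
          exact hbound x hx _ (Nat.sub_le _ _)
      _ = ∑ i ∈ Finset.range (n + 1), (n.choose i : ℝ) *
          (‖x‖ ^ k * ‖iteratedFDeriv ℝ i χ x‖ + ‖x‖ ^ (k + 1) * ‖iteratedFDeriv ℝ i χ x‖) * B := by
          rw [Finset.mul_sum]
          refine Finset.sum_congr rfl fun i _ => ?_
          ring
      _ ≤ _ := by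
          rw [Finset.sum_mul]
          gcongr with i hi
          · exact SchwartzMap.le_seminorm ℂ k i χ x
          · exact SchwartzMap.le_seminorm ℂ (k + 1) i χ x
  · have : iteratedFDeriv ℝ n (fun x => χ x * h x) x = 0 := by
      refine image_eq_zero_of_notMem_tsupport fun hx' => hx ?_
      exact (tsupport_mul_subset_left (f := χ) (g := h)) (tsupport_iteratedFDeriv_subset n hx')
    rw [this]
    simp only [norm_zero, mul_zero]
    positivity

theorem exists_continuous_seminorm_le (q : Seminorm ℂ 𝓢(E, ℂ)) (hq : Continuous q) :
    ∃ (C : ℝ) (M : ℕ), 0 ≤ C ∧ ∀ φ, q φ ≤ C * ∑ k ∈ Finset.range (M + 1),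
      ∑ n ∈ Finset.range (M + 1), SchwartzMap.seminorm ℂ k n φ := by
  obtain ⟨s, C, -, hs⟩ := Seminorm.bound_of_continuous (schwartz_withSeminorms ℂ E ℂ) q hq
  obtain ⟨M, hM⟩ : ∃ M, ∀ p ∈ s, p.1 ≤ M ∧ p.2 ≤ M :=
    ⟨s.sup fun p => max p.1 p.2, fun p hp => by
      have := Finset.le_sup (f := fun p : ℕ × ℕ => max p.1 p.2) hp
      exact ⟨(le_max_left _ _).trans this, (le_max_right _ _).trans this⟩⟩
  refine ⟨C, M, C.2, fun φ => (hs φ).trans ?_⟩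
  change (C : ℝ) * (s.sup (schwartzSeminormFamily ℂ E ℂ)) φ ≤ _
  gcongr
  refine Seminorm.finset_sup_apply_le (by positivity) fun p hp => ?_
  have h1 : ∀ k, 0 ≤ ∑ n ∈ Finset.range (M + 1), SchwartzMap.seminorm ℂ k n φ := fun k => by
    positivity
  calc SchwartzMap.seminorm ℂ p.1 p.2 φ
      ≤ ∑ n ∈ Finset.range (M + 1), SchwartzMap.seminorm ℂ p.1 n φ :=
        Finset.single_le_sum (f := fun n => SchwartzMap.seminorm ℂ p.1 n φ)
          (fun _ _ => by positivity) (Finset.mem_range.2 (Nat.lt_succ_of_le (hM p hp).2))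
    _ ≤ _ := Finset.single_le_sum
          (f := fun k => ∑ n ∈ Finset.range (M + 1), SchwartzMap.seminorm ℂ k n φ)
          (fun k _ => h1 k) (Finset.mem_range.2 (Nat.lt_succ_of_le (hM p hp).1))

/-- The common source of limits, holomorphy and decay below: continuity of q reduces everything to
finitely many derivatives of h on the support of χ. The weight 1 + ‖x‖ is harmless since χ decays,
and is needed for differences of dilations. -/
theorem exists_continuous_seminorm_mul_le (q : Seminorm ℂ 𝓢(E, ℂ)) (hq : Continuous q)
    (χ : 𝓢(E, ℂ)) :
    ∃ (C : ℝ) (M : ℕ), 0 ≤ C ∧ ∀ (h : E → ℂ) (B : ℝ), ContDiff ℝ ∞ h → 0 ≤ B →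
      (∀ x ∈ tsupport χ, ∀ j ≤ M, ‖iteratedFDeriv ℝ j h x‖ ≤ B * (1 + ‖x‖)) →
      ∀ φ : 𝓢(E, ℂ), (∀ x, φ x = χ x * h x) → q φ ≤ C * B := by
  obtain ⟨C, M, hC, hCM⟩ := exists_continuous_seminorm_le q hq
  choose D hD0 hD using exists_seminorm_mul_le χ
  refine ⟨C * ∑ k ∈ Finset.range (M + 1), ∑ n ∈ Finset.range (M + 1), D k n, M, ?_, ?_⟩
  · exact mul_nonneg hC (Finset.sum_nonneg fun k _ => Finset.sum_nonneg fun n _ => hD0 k n)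
  intro h B hh hB hb φ hφ
  refine (hCM φ).trans ?_
  rw [mul_assoc, Finset.sum_mul]
  gcongr with k hk
  rw [Finset.sum_mul]
  gcongr with n hn
  refine hD k n h B hh hB (fun x hx j hj => hb x hx j (hj.trans ?_)) φ hφ
  exact Nat.lt_succ_iff.1 (Finset.mem_range.1 hn)

/-- The seminorm `φ ↦ ‖T φ‖`. -/
noncomputable def functionalSeminorm (T : 𝓢(E, ℂ) →L[ℂ] ℂ) : Seminorm ℂ 𝓢(E, ℂ) :=
  (normSeminorm ℂ ℂ).comp T.toLinearMap

theorem functionalSeminorm_apply (T : 𝓢(E, ℂ) →L[ℂ] ℂ) (φ : 𝓢(E, ℂ)) :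
    functionalSeminorm T φ = ‖T φ‖ := rfl

theorem continuous_functionalSeminorm (T : 𝓢(E, ℂ) →L[ℂ] ℂ) : Continuous (functionalSeminorm T) :=
  T.continuous.norm

/-- Multiplication of a compactly supported Schwartz function by a smooth function. -/
noncomputable def mulSmooth (χ : 𝓢(E, ℂ)) (hχ : HasCompactSupport χ) (h : E → ℂ)
    (hh : ContDiff ℝ ∞ h) : 𝓢(E, ℂ) :=
  (hχ.mul_right (f' := h)).toSchwartzMap ((χ.smooth ⊤).mul hh)

theorem mulSmooth_apply (χ : 𝓢(E, ℂ)) (hχ : HasCompactSupport χ) (h : E → ℂ)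
    (hh : ContDiff ℝ ∞ h) (x : E) : mulSmooth χ hχ h hh x = χ x * h x := rfl

/-- For j = 0 the mean value inequality gives ε‖x‖, whence the weight; for j ≥ 1 the constant drops
out and the dilation yields ε^j ≤ ε. -/
theorem norm_iteratedFDeriv_dilation_sub_le (θ : 𝓢(E, ℂ)) (M : ℕ) :
    ∃ C : ℝ, 0 ≤ C ∧ ∀ ε : ℝ, 0 ≤ ε → ε ≤ 1 → ∀ x : E, ∀ j ≤ M,
      ‖iteratedFDeriv ℝ j (fun x => θ (ε • x) - θ 0) x‖ ≤ C * ε * (1 + ‖x‖) := by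
  set C := SchwartzMap.seminorm ℂ 0 1 θ +
    ∑ j ∈ Finset.range (M + 1), SchwartzMap.seminorm ℂ 0 j θ with hC
  have hC0 : 0 ≤ C := by positivity
  refine ⟨C, hC0, fun ε h0 h1 x j hj => ?_⟩
  rcases j with _ | j
  · simp only [norm_iteratedFDeriv_zero]
    have := convex_univ.norm_image_sub_le_of_norm_fderiv_le (𝕜 := ℝ) (f := θ)
      (C := SchwartzMap.seminorm ℂ 0 1 θ) (x := 0) (y := ε • x)
      (fun x _ => θ.differentiableAt) (fun x _ => by
        have := SchwartzMap.norm_iteratedFDeriv_le_seminorm ℂ θ 1 x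
        rwa [norm_iteratedFDeriv_one] at this) trivial trivial
    refine this.trans ?_
    rw [sub_zero, norm_smul, Real.norm_of_nonneg h0, mul_assoc]
    have : SchwartzMap.seminorm ℂ 0 1 θ ≤ C := le_add_of_nonneg_right (by positivity)
    gcongr
    linarith
  · have e : iteratedFDeriv ℝ (j + 1) (fun x => θ (ε • x) - θ 0) x =
        iteratedFDeriv ℝ (j + 1) (fun x => θ (ε • x)) x := by
      have hs : ContDiff ℝ ∞ fun x => θ (ε • x) := (θ.smooth ⊤).comp (contDiff_const_smul ε)
      have hd : ContDiffAt ℝ ((j + 1 : ℕ) : WithTop ℕ∞) (fun x => θ (ε • x)) x :=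
        (hs.of_le (mod_cast le_top)).contDiffAt
      rw [fun_iteratedFDeriv_sub_apply hd contDiffAt_const,
        iteratedFDeriv_const_of_ne (Nat.succ_ne_zero j)]
      simp
    rw [e, iteratedFDeriv_comp_const_smul ε (θ.smooth _)]
    simp only [norm_smul, norm_pow, Real.norm_of_nonneg h0]
    calc ε ^ (j + 1) * ‖iteratedFDeriv ℝ (j + 1) θ (ε • x)‖ ≤ ε * C := by
          gcongr
          · exact pow_le_of_le_one h0 h1 (Nat.succ_ne_zero j)
          · refine (SchwartzMap.norm_iteratedFDeriv_le_seminorm ℂ θ (j + 1) _).trans ?_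
            refine (Finset.single_le_sum (f := fun j => SchwartzMap.seminorm ℂ 0 j θ)
              (fun _ _ => by positivity) (Finset.mem_range.2 (Nat.lt_succ_of_le hj))).trans ?_
            exact le_add_of_nonneg_left (by positivity)
      _ = C * ε * 1 := by ring
      _ ≤ _ := by gcongr; linarith [norm_nonneg x]

/-- `φ θ(ε ·) → θ(0) φ` weakly as `ε → 0`. -/
theorem tendsto_apply_dilation (T : 𝓢(E, ℂ) →L[ℂ] ℂ) (φ θ : 𝓢(E, ℂ)) (ψ : ℝ → 𝓢(E, ℂ))
    (hψ : ∀ ε > 0, ∀ x, ψ ε x = φ x * θ (ε • x)) :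
    Filter.Tendsto (fun ε => T (ψ ε)) (nhdsWithin 0 (Set.Ioi 0)) (nhds (θ 0 * T φ)) := by
  obtain ⟨C, M, hC, hCM⟩ := exists_continuous_seminorm_mul_le (functionalSeminorm T)
    (continuous_functionalSeminorm T) φ
  obtain ⟨D, hD, hDM⟩ := norm_iteratedFDeriv_dilation_sub_le θ M
  rw [tendsto_iff_norm_sub_tendsto_zero]
  refine squeeze_zero' (g := fun ε => C * (D * ε)) (Filter.Eventually.of_forall fun _ => norm_nonneg _)
    ?_ ?_
  · filter_upwards [self_mem_nhdsWithin, mem_nhdsWithin_of_mem_nhds (Iic_mem_nhds one_pos)]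
      with ε h0 h1
    have h0' : (0 : ℝ) < ε := h0
    have := hCM (fun x => θ (ε • x) - θ 0) (D * ε)
      (((θ.smooth ⊤).comp (contDiff_const_smul ε)).sub contDiff_const) (by positivity)
      (fun x _ j hj => hDM ε h0'.le h1 x j hj) (ψ ε - θ 0 • φ) (fun x => by
        simp [hψ ε h0]; ring)
    rw [functionalSeminorm_apply, map_sub, map_smul, smul_eq_mul] at this
    exact this
  · have : Filter.Tendsto (fun ε : ℝ => C * (D * ε)) (nhds 0) (nhds (C * (D * 0))) := by
      refine Continuous.tendsto ?_ 0
      fun_prop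
    simpa using this.mono_left nhdsWithin_le_nhds

end Schwartz

/-! ### Cutoffs with derivative bounds uniform in the set. -/

section Cutoff

open scoped ContDiff Convolution
open Metric

variable {E : Type} [NormedAddCommGroup E] [NormedSpace ℝ E] [MeasurableSpace E] [BorelSpace E]
  [FiniteDimensional ℝ E]

/-- All derivatives fall on ψ, so the bound does not depend on u. The codomain F varies in the
induction because `fderiv` changes it. -/
theorem norm_iteratedFDeriv_convolution_le (μ : Measure E) [μ.IsAddHaarMeasure] {u : E → ℝ}
    (hu : LocallyIntegrable u μ) (hu1 : ∀ x, ‖u x‖ ≤ 1) (k : ℕ) :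
    ∀ {F : Type} [NormedAddCommGroup F] [NormedSpace ℝ F] {ψ : E → F}, ContDiff ℝ ∞ ψ →
      HasCompactSupport ψ → ∀ x, ‖iteratedFDeriv ℝ k (u ⋆[ContinuousLinearMap.lsmul ℝ ℝ, μ] ψ) x‖ ≤
        ∫ y, ‖iteratedFDeriv ℝ k ψ y‖ ∂μ := by
  induction k with
  | zero =>
    intro F _ _ ψ hψ hc x
    simp only [norm_iteratedFDeriv_zero]
    have hi : Integrable ψ μ := hψ.continuous.integrable_of_hasCompactSupport hc
    rw [convolution_def, ← integral_sub_left_eq_self (fun y => ‖ψ y‖) μ x]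
    refine norm_integral_le_of_norm_le (hi.norm.comp_sub_left x) (.of_forall fun t => ?_)
    simp only [ContinuousLinearMap.lsmul_apply, norm_smul]
    exact mul_le_of_le_one_left (norm_nonneg _) (hu1 t)
  | succ k ih =>
    intro F _ _ ψ hψ hc x
    have hf : fderiv ℝ (u ⋆[ContinuousLinearMap.lsmul ℝ ℝ, μ] ψ) =
        u ⋆[ContinuousLinearMap.lsmul ℝ ℝ, μ] fderiv ℝ ψ := by
      ext1 y
      rw [(hc.hasFDerivAt_convolution_right _ hu (hψ.of_le (mod_cast le_top)) y).fderiv]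
      rfl
    rw [← norm_iteratedFDeriv_fderiv, hf]
    simp_rw [← norm_iteratedFDeriv_fderiv (n := k) (f := ψ)]
    exact ih (hψ.fderiv_right (by simp)) (hc.fderiv ℝ) x

/-- Smooth cutoffs at unit scale, with derivative bounds independent of the set. -/
theorem exists_unit_cutoff (E : Type) [NormedAddCommGroup E] [NormedSpace ℝ E]
    [FiniteDimensional ℝ E] :
    ∃ C : ℕ → ℝ, ∀ B : Set E, ∃ χ : E → ℝ, ContDiff ℝ ∞ χ ∧
      (∀ x ∈ thickening (1 / 4) B, χ x = 1) ∧ (∀ x, χ x ≠ 0 → x ∈ thickening 1 B) ∧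
      ∀ k x, ‖iteratedFDeriv ℝ k χ x‖ ≤ C k := by
  borelize E
  let μ : Measure E := Measure.addHaar
  -- The mollifier has radius 1/4 and acts on the indicator of the 1/2-thickening, so the result is
  -- 1 on the 1/4-thickening and vanishes off the 1-thickening.
  let b : ContDiffBump (0 : E) := ⟨1 / 8, 1 / 4, by norm_num, by norm_num⟩
  have hψ : ContDiff ℝ ∞ (b.normed μ) := b.contDiff_normed
  have hc : HasCompactSupport (b.normed μ) := b.hasCompactSupport_normed
  refine ⟨fun k => ∫ y, ‖iteratedFDeriv ℝ k (b.normed μ) y‖ ∂μ, fun B => ?_⟩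
  set u : E → ℝ := (thickening (1 / 2) B).indicator 1 with hu_def
  have hu : LocallyIntegrable u μ :=
    (locallyIntegrable_const (1 : ℝ)).indicator isOpen_thickening.measurableSet
  have hu1 : ∀ x, ‖u x‖ ≤ 1 := fun x => by
    exact (norm_indicator_le_norm_self _ _).trans (by simp)
  -- The derivative bound wants the bump on the right; evaluation where u is locally constant wants
  -- it on the left.
  have hflip : u ⋆[ContinuousLinearMap.lsmul ℝ ℝ, μ] (b.normed μ) =
      b.normed μ ⋆[ContinuousLinearMap.lsmul ℝ ℝ, μ] u := by
    rw [← convolution_flip]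
    congr 1
    ext
    simp
  refine ⟨u ⋆[ContinuousLinearMap.lsmul ℝ ℝ, μ] (b.normed μ),
    hc.contDiff_convolution_right _ hu hψ, fun x hx => ?_, fun x hx => ?_,
    fun k x => norm_iteratedFDeriv_convolution_le μ hu hu1 k hψ hc x⟩
  · have h1 : ∀ y ∈ ball x (1 / 4), u y = 1 := fun y hy => by
      obtain ⟨a, ha, hxa⟩ := mem_thickening_iff.1 hx
      refine Set.indicator_of_mem (mem_thickening_iff.2 ⟨a, ha, ?_⟩) _
      have := dist_triangle y x a
      rw [mem_ball] at hy
      linarith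
    have h0 := h1 x (mem_ball_self (by norm_num))
    rw [hflip, b.normed_convolution_eq_right (fun y hy => by rw [h0]; exact h1 y hy), h0]
  · by_contra hx1
    have h1 : ∀ y ∈ ball x (1 / 4), u y = 0 := fun y hy => by
      refine Set.indicator_of_notMem (fun hy' => hx1 ?_) _
      obtain ⟨a, ha, hya⟩ := mem_thickening_iff.1 hy'
      refine mem_thickening_iff.2 ⟨a, ha, ?_⟩
      have := dist_triangle_left x a y
      rw [mem_ball] at hy
      linarith
    have h0 := h1 x (mem_ball_self (by norm_num))
    rw [hflip, b.normed_convolution_eq_right (fun y hy => by rw [h0]; exact h1 y hy), h0] at hx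
    exact hx rfl

/-- Smooth cutoffs at scale `δ`, with derivative bounds independent of the set. -/
theorem exists_cutoff (E : Type) [NormedAddCommGroup E] [NormedSpace ℝ E]
    [FiniteDimensional ℝ E] :
    ∃ C : ℕ → ℝ, (∀ k, 0 ≤ C k) ∧ ∀ (B : Set E) (δ : ℝ), 0 < δ →
      ∃ χ : E → ℂ, ContDiff ℝ ∞ χ ∧
      (∀ x ∈ thickening (δ / 4) B, χ x = 1) ∧ (∀ x, χ x ≠ 0 → x ∈ thickening δ B) ∧
      ∀ k x, ‖iteratedFDeriv ℝ k χ x‖ ≤ C k * δ⁻¹ ^ k := by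
  obtain ⟨C, hC⟩ := exists_unit_cutoff E
  have hC0 : ∀ k, 0 ≤ C k := fun k => by
    obtain ⟨χ, -, -, -, h⟩ := hC ∅
    exact (norm_nonneg _).trans (h k 0)
  refine ⟨C, hC0, fun B δ hδ => ?_⟩
  obtain ⟨χ, hs, h1, h0, hb⟩ := hC ((δ⁻¹ • ·) '' B)
  have hs' : ContDiff ℝ ∞ fun x => χ (δ⁻¹ • x) := hs.comp (contDiff_const_smul _)
  have hdist : ∀ x a : E, dist (δ⁻¹ • x) (δ⁻¹ • a) = δ⁻¹ * dist x a := fun x a => by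
    rw [dist_smul₀, Real.norm_of_nonneg (by positivity)]
  refine ⟨fun x => (χ (δ⁻¹ • x) : ℂ), Complex.ofRealCLM.contDiff.comp hs', fun x hx => ?_,
    fun x hx => ?_, fun k x => ?_⟩
  · dsimp only
    rw [h1, Complex.ofReal_one]
    obtain ⟨a, ha, hxa⟩ := mem_thickening_iff.1 hx
    refine mem_thickening_iff.2 ⟨_, ⟨a, ha, rfl⟩, ?_⟩
    dsimp only
    rw [hdist, inv_mul_lt_iff₀ hδ]
    linarith
  · obtain ⟨_, ⟨a, ha, rfl⟩, hxa⟩ := mem_thickening_iff.1 (h0 _ (Complex.ofReal_ne_zero.1 hx))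
    refine mem_thickening_iff.2 ⟨a, ha, ?_⟩
    dsimp only at hxa
    rw [hdist, inv_mul_lt_iff₀ hδ] at hxa
    linarith
  · refine (Complex.ofRealCLM.norm_iteratedFDeriv_comp_left (N := ∞) (n := k) hs'.contDiffAt
      (mod_cast le_top)).trans ?_
    rw [Complex.ofRealCLM_norm, one_mul, iteratedFDeriv_comp_const_smul _ (hs.of_le
      (mod_cast le_top))]
    simp only [norm_smul, norm_pow, Real.norm_of_nonneg (inv_nonneg.2 hδ.le)]
    rw [mul_comm]
    gcongr
    exact hb k _

end Cutoff

/-! ### Vanishing of a distribution off its support. -/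

section Support

open scoped ContDiff
open Metric Distribution

variable {E : Type} [NormedAddCommGroup E] [NormedSpace ℝ E] [FiniteDimensional ℝ E]

/-- A smooth function equal to `1` near a compact set and supported in a given neighbourhood. -/
theorem exists_schwartz_cutoff {K U : Set E} (hK : IsCompact K) (hU : IsOpen U) (hKU : K ⊆ U) :
    ∃ χ : 𝓢(E, ℂ), HasCompactSupport χ ∧ tsupport χ ⊆ U ∧
      ∃ δ > 0, ∀ x ∈ thickening δ K, χ x = 1 := by
  obtain ⟨δ, hδ, hδU⟩ := hK.exists_cthickening_subset_open hU hKU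
  obtain ⟨C, -, hC⟩ := exists_cutoff E
  obtain ⟨χ, hs, h1, h0, -⟩ := hC K δ hδ
  have hsub : tsupport χ ⊆ cthickening δ K :=
    closure_minimal (fun x hx => thickening_subset_cthickening _ _ (h0 x hx)) isClosed_cthickening
  have hc : HasCompactSupport χ := hK.cthickening.of_isClosed_subset (isClosed_tsupport _) hsub
  exact ⟨hc.toSchwartzMap hs, hc, hsub.trans hδU, δ / 4, by positivity, h1⟩

/-- A two-set partition of unity: a cutoff equal to 1 near the compact part of the support of φ
outside V₂ splits φ into a piece in V₁ and a piece in V₂. -/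
theorem apply_eq_zero_of_tsupport_subset_union (T : 𝓢(E, ℂ) →L[ℂ] ℂ) {V₁ V₂ : Set E}
    (hV₁ : IsOpen V₁)
    (h₁ : ∀ φ : 𝓢(E, ℂ), HasCompactSupport φ → tsupport φ ⊆ V₁ → T φ = 0)
    (h₂ : ∀ φ : 𝓢(E, ℂ), HasCompactSupport φ → tsupport φ ⊆ V₂ → T φ = 0) (hV₂ : IsOpen V₂)
    (φ : 𝓢(E, ℂ)) (hφ : HasCompactSupport φ) (hV : tsupport φ ⊆ V₁ ∪ V₂) : T φ = 0 := by
  have hK : IsCompact (tsupport φ \ V₂) := hφ.diff hV₂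
  obtain ⟨χ, hχ, hχV, δ, hδ, hχ1⟩ := exists_schwartz_cutoff hK hV₁
    (fun x hx => (hV hx.1).resolve_right hx.2)
  set ψ := mulSmooth χ hχ φ (φ.smooth ⊤) with hψ
  have hψ1 : tsupport ψ ⊆ tsupport χ := tsupport_mul_subset_left (f := χ) (g := φ)
  have hψ2 : tsupport ψ ⊆ tsupport φ := tsupport_mul_subset_right (f := χ) (g := φ)
  have e : φ = ψ + (φ - ψ) := by abel
  have hsub : tsupport (φ - ψ : 𝓢(E, ℂ)) ⊆ tsupport φ := by
    refine closure_minimal (fun x hx => ?_) (isClosed_tsupport _)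
    by_contra hx'
    have h0 : φ x = 0 := image_eq_zero_of_notMem_tsupport hx'
    exact hx (by simp [hψ, mulSmooth_apply, h0])
  rw [e, map_add, h₁ ψ (hχ.mul_right) (hψ1.trans hχV), h₂ (φ - ψ), add_zero]
  · exact hφ.of_isClosed_subset (isClosed_tsupport _) hsub
  · intro x hx
    by_contra hx2
    refine notMem_tsupport_iff_eventuallyEq.2 ?_ hx
    filter_upwards [isOpen_thickening.mem_nhds
      (self_subset_thickening hδ (tsupport φ \ V₂) ⟨hsub hx, hx2⟩)] with y hy
    simp [hψ, mulSmooth_apply, hχ1 y hy]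

theorem apply_eq_zero_of_hasCompactSupport (T : 𝓢(E, ℂ) →L[ℂ] ℂ) (φ : 𝓢(E, ℂ))
    (hφ : HasCompactSupport φ) (hd : Disjoint (tsupport φ) (dsupport T)) : T φ = 0 := by
  suffices h : ∃ V, tsupport φ ⊆ V ∧ IsOpen V ∧
      ∀ ψ : 𝓢(E, ℂ), HasCompactSupport ψ → tsupport ψ ⊆ V → T ψ = 0 by
    obtain ⟨V, hV, -, h⟩ := h
    exact h φ hφ hV
  refine IsCompact.induction_on hφ (p := fun s => ∃ V, s ⊆ V ∧ IsOpen V ∧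
      ∀ ψ : 𝓢(E, ℂ), HasCompactSupport ψ → tsupport ψ ⊆ V → T ψ = 0) ?_ ?_ ?_ ?_
  · refine ⟨∅, subset_rfl, isOpen_empty, fun ψ _ hψ => ?_⟩
    have : ψ = 0 := by
      ext x
      exact image_eq_zero_of_notMem_tsupport fun hx => hψ hx
    rw [this, map_zero]
  · rintro s t hst ⟨V, hV, h⟩
    exact ⟨V, hst.trans hV, h⟩
  · rintro s t ⟨V₁, hs, ho₁, h₁⟩ ⟨V₂, ht, ho₂, h₂⟩
    exact ⟨V₁ ∪ V₂, Set.union_subset_union hs ht, ho₁.union ho₂,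
      apply_eq_zero_of_tsupport_subset_union T ho₁ h₁ h₂ ho₂⟩
  · intro x hx
    obtain ⟨s, hs, ho, hxs⟩ := (notMem_dsupport_iff (f := T) x).1 (Set.disjoint_left.1 hd hx)
    exact ⟨s, mem_nhdsWithin_of_mem_nhds (ho.mem_nhds hxs), s, subset_rfl, ho,
      fun ψ _ hψ => hs ψ hψ⟩

/-- A tempered distribution vanishes on Schwartz functions supported off its support. -/
theorem apply_eq_zero_of_disjoint (T : 𝓢(E, ℂ) →L[ℂ] ℂ) (φ : 𝓢(E, ℂ))
    (hd : Disjoint (tsupport φ) (dsupport T)) : T φ = 0 := by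
  obtain ⟨θ, hθ, -, δ, hδ, hθ1⟩ := exists_schwartz_cutoff (isCompact_singleton (x := (0 : E)))
    isOpen_univ (Set.subset_univ _)
  have hθ0 : θ 0 = 1 := hθ1 0 (self_subset_thickening hδ _ rfl)
  have hex : ∀ ε : ℝ, ∃ ψ : 𝓢(E, ℂ), ε > 0 → HasCompactSupport ψ ∧
      ∀ x, ψ x = φ x * θ (ε • x) := fun ε => by
    by_cases hε : ε > 0
    · have hc : HasCompactSupport fun x => φ x * θ (ε • x) := (hθ.comp_smul hε.ne').mul_left
      exact ⟨hc.toSchwartzMap ((φ.smooth ⊤).mul ((θ.smooth ⊤).comp (contDiff_const_smul ε))),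
        fun _ => ⟨hc, fun _ => rfl⟩⟩
    · exact ⟨0, fun h => absurd h hε⟩
  choose ψ hψ using hex
  have hlim := tendsto_apply_dilation T φ θ ψ fun ε hε => (hψ ε hε).2
  rw [hθ0, one_mul] at hlim
  refine tendsto_nhds_unique hlim (tendsto_const_nhds.congr' ?_)
  filter_upwards [self_mem_nhdsWithin] with ε hε
  refine (apply_eq_zero_of_hasCompactSupport T _ (hψ ε hε).1 (hd.mono_left ?_)).symm
  refine closure_mono fun x hx hx' => hx ?_
  rw [(hψ ε hε).2, hx', zero_mul]

theorem apply_congr_of_eq_on_thickening (T : 𝓢(E, ℂ) →L[ℂ] ℂ) {A : Set E} (hT : dsupport T ⊆ A)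
    {δ : ℝ} (hδ : 0 < δ) {φ ψ : 𝓢(E, ℂ)} (h : ∀ x ∈ thickening δ A, φ x = ψ x) : T φ = T ψ := by
  rw [← sub_eq_zero, ← map_sub]
  refine apply_eq_zero_of_disjoint T _ (Set.disjoint_left.2 fun x hx hxT => ?_)
  refine notMem_tsupport_iff_eventuallyEq.2 ?_ hx
  filter_upwards [isOpen_thickening.mem_nhds (self_subset_thickening hδ _ (hT hxT))] with y hy
  simp [h y hy]

end Support

/-! ### Holomorphy of z ↦ T(χ e^{l(z)}). -/

section Entire

open scoped ContDiff
open Metric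

variable {E : Type*} [NormedAddCommGroup E] [NormedSpace ℝ E]
  {V : Type*} [NormedAddCommGroup V] [NormedSpace ℂ V] [FiniteDimensional ℂ V]

/-- The Fourier–Laplace transform of a compactly supported distribution is entire. -/
theorem differentiable_apply_exp (T : 𝓢(E, ℂ) →L[ℂ] ℂ) (l : V →ₗ[ℂ] E →L[ℝ] ℂ)
    (hl : ∀ z, ‖l z‖ ≤ ‖z‖) (χ : 𝓢(E, ℂ)) (hχ : HasCompactSupport χ) (G : V → 𝓢(E, ℂ))
    (hG : ∀ z x, G z x = χ x * Complex.exp (l z x)) : Differentiable ℂ fun z => T (G z) := by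
  intro z
  have hGs : tsupport (G z) ⊆ tsupport χ := by
    refine closure_mono fun x hx hx' => hx ?_
    rw [hG, hx', zero_mul]
  have hGc : HasCompactSupport (G z) := hχ.of_isClosed_subset (isClosed_tsupport _) hGs
  obtain ⟨C, M, hC, hCM⟩ := exists_continuous_seminorm_mul_le (functionalSeminorm T)
    (continuous_functionalSeminorm T) (G z)
  obtain ⟨R, hR1, hR⟩ : ∃ R : ℝ, 1 ≤ R ∧ ∀ x ∈ tsupport (G z), ‖x‖ ≤ R := by
    obtain ⟨R, hR⟩ := hGc.isBounded.exists_norm_le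
    exact ⟨max 1 R, le_max_left _ _, fun x hx => (hR x hx).trans (le_max_right _ _)⟩
  let P : V → 𝓢(E, ℂ) := fun h => mulSmooth (G z) hGc (l h) (l h).contDiff
  -- The candidate derivative at z is h ↦ T(G(z) l(h)); the remainder is T applied to G(z)(e^{l(h)}
  -- - 1 - l(h)), which is O(‖h‖²).
  let D : V →ₗ[ℂ] ℂ :=
    { toFun := fun h => T (P h)
      map_add' := fun h k => by
        rw [← map_add]
        congr 1
        ext x
        simp [P, mulSmooth_apply, mul_add]
      map_smul' := fun c h => by
        rw [RingHom.id_apply, ← map_smul]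
        congr 1
        ext x
        simp [P, mulSmooth_apply, mul_left_comm] }
  refine HasFDerivAt.differentiableAt (f' := LinearMap.toContinuousLinearMap D) ?_
  rw [hasFDerivAt_iff_isLittleO_nhds_zero]
  refine Asymptotics.IsBigO.trans_isLittleO (g := fun h : V => ‖h‖ ^ 2) ?_
    (Asymptotics.isLittleO_norm_pow_id one_lt_two)
  refine Asymptotics.IsBigO.of_bound (C * (3 * R ^ 2)) ?_
  filter_upwards [closedBall_mem_nhds (0 : V) (inv_pos.2 (one_pos.trans_le hR1))] with h hh
  rw [mem_closedBall_zero_iff] at hh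
  have hlR : ‖l h‖ * R ≤ 1 := by
    calc ‖l h‖ * R ≤ R⁻¹ * R := by gcongr; exact (hl h).trans hh
      _ = 1 := inv_mul_cancel₀ (by positivity)
  have key := hCM (fun x => Complex.exp (l h x) - 1 - l h x) (3 * R ^ 2 * ‖l h‖ ^ 2)
    (((contDiff_exp_clm (l h)).sub contDiff_const).sub (l h).contDiff) (by positivity)
    (fun x hx j _ => (norm_iteratedFDeriv_exp_sub_le hR1 (l h) hlR j (hR x hx)).trans
      (le_mul_of_one_le_right (by positivity) (by linarith [norm_nonneg x])))
    (G (z + h) - G z - P h) (fun x => by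
      simp [P, mulSmooth_apply, hG, Complex.exp_add]
      ring)
  rw [functionalSeminorm_apply, map_sub, map_sub] at key
  refine key.trans ?_
  rw [norm_pow, norm_norm, ← mul_assoc]
  gcongr
  exact hl h

end Entire

/-! ### The form -i z·x and the supporting function. -/

section Forms

variable {d : ℕ}

theorem norm_realToComplex (x : EuclideanSpace ℝ (Fin d)) : ‖realToComplex x‖ = ‖x‖ := by
  simp [EuclideanSpace.norm_eq, realToComplex]

theorem norm_imPart_le (z : EuclideanSpace ℂ (Fin d)) : ‖imPart z‖ ≤ ‖z‖ := by
  rw [EuclideanSpace.norm_eq, EuclideanSpace.norm_eq]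
  refine Real.sqrt_le_sqrt (Finset.sum_le_sum fun j _ => ?_)
  have : ‖imPart z j‖ ≤ ‖z j‖ := Complex.abs_im_le_norm (z j)
  gcongr

theorem norm_neg_I_mul_sum_le (z : EuclideanSpace ℂ (Fin d)) (x : EuclideanSpace ℝ (Fin d)) :
    ‖-Complex.I * ∑ j, z j * (x j : ℂ)‖ ≤ ‖z‖ * ‖x‖ := by
  have h : ∑ j, z j * (x j : ℂ) = inner ℂ (realToComplex x) z := by
    simp [PiLp.inner_apply, realToComplex]
  rw [h, norm_mul, norm_neg, Complex.norm_I, one_mul, mul_comm, ← norm_realToComplex x]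
  exact norm_inner_le_norm _ _

/-- The real-linear form `x ↦ -i z·x`, as a complex-linear function of `z ∈ ℂ^d`. -/
noncomputable def fourierForm (d : ℕ) :
    EuclideanSpace ℂ (Fin d) →ₗ[ℂ] EuclideanSpace ℝ (Fin d) →L[ℝ] ℂ where
  toFun z := LinearMap.mkContinuous
    { toFun := fun x => -Complex.I * ∑ j, z j * (x j : ℂ)
      map_add' := fun x y => by simp [mul_add, Finset.sum_add_distrib]
      map_smul' := fun c x => by
        simp only [PiLp.smul_apply, smul_eq_mul, Complex.ofReal_mul, RingHom.id_apply,
          Complex.real_smul, Finset.mul_sum]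
        exact Finset.sum_congr rfl fun j _ => by ring }
    ‖z‖ (norm_neg_I_mul_sum_le z)
  map_add' z w := by
    ext x
    simp [mul_add, add_mul, Finset.sum_add_distrib]
  map_smul' c z := by
    ext x
    simp only [PiLp.smul_apply, smul_eq_mul, LinearMap.mkContinuous_apply, LinearMap.coe_mk,
      AddHom.coe_mk, RingHom.id_apply, _root_.smul_apply, Finset.mul_sum]
    exact Finset.sum_congr rfl fun j _ => by ring

theorem fourierForm_apply (z : EuclideanSpace ℂ (Fin d)) (x : EuclideanSpace ℝ (Fin d)) :
    fourierForm d z x = -Complex.I * ∑ j, z j * (x j : ℂ) := rfl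

theorem norm_fourierForm_le (z : EuclideanSpace ℂ (Fin d)) : ‖fourierForm d z‖ ≤ ‖z‖ :=
  LinearMap.mkContinuous_norm_le _ (norm_nonneg z) (norm_neg_I_mul_sum_le z)

theorem fourierForm_apply_re (z : EuclideanSpace ℂ (Fin d)) (x : EuclideanSpace ℝ (Fin d)) :
    (fourierForm d z x).re = ⟪x, imPart z⟫ := by
  simp [fourierForm_apply, PiLp.inner_apply, imPart]

theorem fourierForm_realToComplex (ξ x : EuclideanSpace ℝ (Fin d)) :
    fourierForm d (realToComplex ξ) x = -Complex.I * (⟪ξ, x⟫ : ℝ) := by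
  simp [fourierForm_apply, PiLp.inner_apply, realToComplex, mul_comm]

theorem inner_le_supportingFunction {A : Set (EuclideanSpace ℝ (Fin d))} (hA : IsCompact A)
    {a : EuclideanSpace ℝ (Fin d)} (ha : a ∈ A) (y : EuclideanSpace ℝ (Fin d)) :
    ⟪a, y⟫ ≤ supportingFunction A y :=
  le_csSup (hA.image (by fun_prop)).bddAbove ⟨a, ha, rfl⟩

theorem inner_le_of_mem_thickening {A : Set (EuclideanSpace ℝ (Fin d))} (hA : IsCompact A)
    {δ : ℝ} {x : EuclideanSpace ℝ (Fin d)} (hx : x ∈ Metric.thickening δ A)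
    (y : EuclideanSpace ℝ (Fin d)) : ⟪x, y⟫ ≤ supportingFunction A y + δ * ‖y‖ := by
  obtain ⟨a, ha, hxa⟩ := Metric.mem_thickening_iff.1 hx
  have h : ⟪x, y⟫ = ⟪a, y⟫ + ⟪x - a, y⟫ := by rw [← inner_add_left]; simp
  rw [h]
  refine add_le_add (inner_le_supportingFunction hA ha y) ((real_inner_le_norm _ _).trans ?_)
  rw [dist_eq_norm] at hxa
  gcongr

end Forms

/-! ### Pointwise values of the Fourier transform. -/

section Representation

open scoped ContDiff
open Metric Distribution Filter Topology

variable {d : ℕ}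

theorem integral_eq_pow_smul_integral_dilation {F : Type*} [NormedAddCommGroup F] [NormedSpace ℝ F]
    (k : EuclideanSpace ℝ (Fin d) → F) (ξ : EuclideanSpace ℝ (Fin d)) {ε : ℝ} (hε : 0 < ε) :
    ∫ x, k x = ε ^ d • ∫ u, k (ξ + ε • u) := by
  have h := Measure.integral_comp_smul volume (fun x => k (ξ + x)) ε
  rw [h, integral_add_left_eq_self k ξ, finrank_euclideanSpace_fin, abs_of_pos (by positivity),
    smul_inv_smul₀ (by positivity)]

theorem fourierSchwartz_zero_apply (φ : 𝓢(EuclideanSpace ℝ (Fin d), ℂ)) :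
    fourierSchwartz d φ 0 = ((((2 * Real.pi) ^ ((d : ℝ) / 2))⁻¹ : ℝ) : ℂ) * ∫ x, φ x := by
  rw [fourierSchwartz_apply]
  simp

theorem exists_schwartz_integral_eq_one (d : ℕ) :
    ∃ ρ : 𝓢(EuclideanSpace ℝ (Fin d), ℂ), HasCompactSupport ρ ∧ ∫ x, ρ x = 1 := by
  let b : ContDiffBump (0 : EuclideanSpace ℝ (Fin d)) := ⟨1, 2, by norm_num, by norm_num⟩
  have hc : HasCompactSupport fun x => (b.normed volume x : ℂ) :=
    (b.hasCompactSupport_normed (μ := volume)).comp_left (g := Complex.ofReal) rfl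
  refine ⟨hc.toSchwartzMap (Complex.ofRealCLM.contDiff.comp b.contDiff_normed), hc, ?_⟩
  change ∫ x, (b.normed volume x : ℂ) = 1
  rw [integral_complex_ofReal, b.integral_normed, Complex.ofReal_one]

/-- A distribution `T` with compact support has Fourier transform `(2π)^{-d/2} T(e^{-i ξ·x})`. -/
theorem IsFourierTransformOf.eq_apply_exp {f : EuclideanSpace ℝ (Fin d) → ℂ}
    {T : 𝓢'(EuclideanSpace ℝ (Fin d), ℂ)} (hf : IsFourierTransformOf f T)
    {A : Set (EuclideanSpace ℝ (Fin d))} (hT : dsupport T ⊆ A)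
    (χ : 𝓢(EuclideanSpace ℝ (Fin d), ℂ)) (hχ : HasCompactSupport χ) {δ : ℝ} (hδ : 0 < δ)
    (hχ1 : ∀ x ∈ thickening δ A, χ x = 1) (ξ : EuclideanSpace ℝ (Fin d)) :
    f ξ = ((((2 * Real.pi) ^ ((d : ℝ) / 2))⁻¹ : ℝ) : ℂ) *
      T (mulSmooth χ hχ _ (contDiff_exp_clm (fourierForm d (realToComplex ξ)))) := by
  obtain ⟨ρ, hρ, hρ1⟩ := exists_schwartz_integral_eq_one d
  have hex : ∀ ε : ℝ, ∃ φ : 𝓢(EuclideanSpace ℝ (Fin d), ℂ), 0 < ε →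
      ∀ u, φ (ξ + ε • u) = ρ u := fun ε => by
    by_cases hε : 0 < ε
    · have hc : HasCompactSupport fun x => ρ (ε⁻¹ • (x - ξ)) :=
        (hρ.comp_smul (inv_ne_zero hε.ne')).comp_homeomorph (Homeomorph.subRight ξ)
      refine ⟨hc.toSchwartzMap ((ρ.smooth ⊤).comp (by fun_prop)), fun _ u => ?_⟩
      simp [smul_smul, inv_mul_cancel₀ hε.ne']
    · exact ⟨0, fun h => absurd h hε⟩
  choose φ hφ using hex
  let T' : 𝓢(EuclideanSpace ℝ (Fin d), ℂ) →L[ℂ] ℂ := T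
  -- The transform of the approximate identity ε^{-d} ρ((x - ξ)/ε) is e^{-iξ·x} (ℱρ)(εx): the
  -- desired exponential times a dilation whose value at 0 supplies (2π)^{-d/2}.
  set ψ : ℝ → 𝓢(EuclideanSpace ℝ (Fin d), ℂ) := fun ε =>
    ((ε : ℂ) ^ d)⁻¹ • fourierSchwartz d (φ ε) with hψ
  have hψx : ∀ ε > 0, ∀ x, ψ ε x =
      Complex.exp (fourierForm d (realToComplex ξ) x) * fourierSchwartz d ρ (ε • x) := by
    intro ε hε x
    have hε0 : (ε : ℂ) ^ d ≠ 0 := pow_ne_zero _ (by exact_mod_cast hε.ne')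
    simp only [hψ, _root_.smul_apply, fourierSchwartz_apply, smul_eq_mul]
    rw [integral_eq_pow_smul_integral_dilation _ ξ hε, Complex.real_smul, Complex.ofReal_pow]
    simp only [hφ ε hε, inner_add_right, fourierForm_realToComplex]
    rw [mul_left_comm, inv_mul_cancel_left₀ hε0, mul_left_comm (Complex.exp _),
      ← integral_const_mul (Complex.exp (-Complex.I * (⟪ξ, x⟫ : ℝ)))]
    congr 1
    refine integral_congr_ae (.of_forall fun u => ?_)
    dsimp only
    rw [mul_left_comm, ← Complex.exp_add, real_inner_comm ξ x, inner_smul_left, inner_smul_right]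
    congr 2
    push_cast
    simp
    ring
  have hTψ : ∀ ε > 0, T' (ψ ε) = ∫ u, f (ξ + ε • u) * ρ u := by
    intro ε hε
    have hε0 : (ε : ℂ) ^ d ≠ 0 := pow_ne_zero _ (by exact_mod_cast hε.ne')
    have h := (hf.2 (φ ε)).2
    rw [fourierTempered_apply, integral_eq_pow_smul_integral_dilation _ ξ hε, Complex.real_smul,
      Complex.ofReal_pow] at h
    simp only [hφ ε hε] at h
    rw [hψ, map_smul, smul_eq_mul]
    change _ * T (fourierSchwartz d (φ ε)) = _
    rw [h, inv_mul_cancel_left₀ hε0]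
  have hcut : ∀ ε, T' (mulSmooth χ hχ (ψ ε) ((ψ ε).smooth ⊤)) = T' (ψ ε) := fun ε =>
    apply_congr_of_eq_on_thickening T' hT hδ fun x hx => by
      rw [mulSmooth_apply, hχ1 x hx, one_mul]
  have hlim := tendsto_apply_dilation T'
    (mulSmooth χ hχ _ (contDiff_exp_clm (fourierForm d (realToComplex ξ)))) (fourierSchwartz d ρ)
    (fun ε => mulSmooth χ hχ (ψ ε) ((ψ ε).smooth ⊤)) (fun ε hε x => by
      rw [mulSmooth_apply, mulSmooth_apply, hψx ε hε, mul_assoc])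
  rw [fourierSchwartz_zero_apply, hρ1, mul_one] at hlim
  refine tendsto_nhds_unique ?_ hlim
  have hcont : Continuous fun ε : ℝ => ∫ u in tsupport ρ, f (ξ + ε • u) * ρ u := by
    refine continuous_parametric_integral_of_continuous ?_ hρ
    exact (hf.1.comp (by fun_prop)).mul (ρ.continuous.comp continuous_snd)
  have hset : ∀ ε : ℝ, ∫ u in tsupport ρ, f (ξ + ε • u) * ρ u = ∫ u, f (ξ + ε • u) * ρ u :=
    fun ε => setIntegral_eq_integral_of_forall_compl_eq_zero fun u hu => by
      rw [image_eq_zero_of_notMem_tsupport hu, mul_zero]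
  have h0 := (hcont.tendsto 0).mono_left (nhdsWithin_le_nhds (s := Set.Ioi 0))
  simp only [hset] at h0
  simp only [zero_smul, add_zero] at h0
  rw [integral_const_mul, hρ1, mul_one] at h0
  refine h0.congr' ?_
  filter_upwards [self_mem_nhdsWithin] with ε hε
  rw [hcut, hTψ ε hε]

end Representation

/-! ### Finite order and the growth bound. -/

section Order

open scoped ContDiff
open Metric Distribution

variable {d : ℕ}

/-- On a compact set the polynomial weights in the seminorms bounding T are themselves bounded. -/
theorem exists_hasOrderAtMost (T : 𝓢'(EuclideanSpace ℝ (Fin d), ℂ)) :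
    ∃ N, HasOrderAtMost T N := by
  obtain ⟨C, M, hC, hCM⟩ := exists_continuous_seminorm_le (functionalSeminorm T)
    (continuous_functionalSeminorm T)
  refine ⟨M, fun K hK => ?_⟩
  obtain ⟨R, hR1, hR⟩ : ∃ R : ℝ, 0 ≤ R ∧ ∀ x ∈ K, ‖x‖ ≤ R := by
    obtain ⟨R, hR⟩ := hK.isBounded.exists_norm_le
    exact ⟨max 0 R, le_max_left _ _, fun x hx => (hR x hx).trans (le_max_right _ _)⟩
  refine ⟨C * ∑ k ∈ Finset.range (M + 1), R ^ k, fun φ hφ => (hCM φ).trans ?_⟩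
  rw [mul_assoc, Finset.sum_mul]
  gcongr with k hk
  rw [Finset.mul_sum]
  gcongr with n hn
  refine SchwartzMap.seminorm_le_bound ℂ k n φ (by positivity) fun x => ?_
  by_cases hx : x ∈ tsupport φ
  · gcongr
    · exact hR x (hφ hx)
    · exact SchwartzMap.norm_iteratedFDeriv_le_seminorm ℂ φ n x
  · rw [image_eq_zero_of_notMem_tsupport fun hx' => hx (tsupport_iteratedFDeriv_subset n hx')]
    simp only [norm_zero, mul_zero]
    positivity

/-- A fixed cutoff would lose a factor e^{δ|Im z|}. With δ = 1/(1+|z|) that loss is bounded, and the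
i-th derivative of the cutoff costs (1+|z|)^i, just as differentiating the exponential does. -/
theorem HasOrderAtMost.exists_norm_apply_exp_le {T : 𝓢'(EuclideanSpace ℝ (Fin d), ℂ)} {N : ℕ}
    (hN : HasOrderAtMost T N) {A : Set (EuclideanSpace ℝ (Fin d))} (hA : IsCompact A)
    (hT : dsupport T ⊆ A) {δ₀ : ℝ} (hδ₀ : 0 < δ₀)
    (G : EuclideanSpace ℂ (Fin d) → 𝓢(EuclideanSpace ℝ (Fin d), ℂ))
    (hG : ∀ z, ∀ x ∈ thickening δ₀ A, G z x = Complex.exp (fourierForm d z x)) :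
    ∃ C : ℝ, ∀ z, ‖T (G z)‖ ≤
      C * (1 + ‖z‖) ^ N * Real.exp (supportingFunction A (imPart z)) := by
  -- As δ ≤ 1, this one compact set contains the supports for all z, so the constant is uniform in
  -- z.
  obtain ⟨C₀, hC₀⟩ := hN (cthickening 1 A) hA.cthickening
  obtain ⟨D, hD0, hD⟩ := exists_cutoff (EuclideanSpace ℝ (Fin d))
  refine ⟨|C₀| * ∑ k ∈ Finset.range (N + 1),
    (∑ i ∈ Finset.range (k + 1), (k.choose i : ℝ) * D i) * Real.exp 2, fun z => ?_⟩
  have hz : 1 ≤ 1 + ‖z‖ := by linarith [norm_nonneg z]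
  have hδ : 0 < (1 + ‖z‖)⁻¹ := by positivity
  obtain ⟨χ, hχs, hχ1, hχ0, hχb⟩ := hD A _ hδ
  rw [inv_inv] at hχb
  have hsub : tsupport χ ⊆ cthickening (1 + ‖z‖)⁻¹ A :=
    closure_minimal (fun x hx => thickening_subset_cthickening _ _ (hχ0 x hx)) isClosed_cthickening
  have hχc : HasCompactSupport χ :=
    hA.cthickening.of_isClosed_subset (isClosed_tsupport _) hsub
  set φ := mulSmooth (hχc.toSchwartzMap hχs) hχc _ (contDiff_exp_clm (fourierForm d z)) with hφ
  have hφx : (φ : EuclideanSpace ℝ (Fin d) → ℂ) =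
    fun x => χ x * Complex.exp (fourierForm d z x) := rfl
  have hφsub : tsupport φ ⊆ tsupport χ := tsupport_mul_subset_left
  have hTφ : T (G z) = T φ := by
    refine apply_congr_of_eq_on_thickening (T : 𝓢(EuclideanSpace ℝ (Fin d), ℂ) →L[ℂ] ℂ) hT
      (lt_min hδ₀ (by positivity : 0 < (1 + ‖z‖)⁻¹ / 4)) fun x hx => ?_
    rw [hG z x (thickening_mono (min_le_left _ _) _ hx), hφx]
    dsimp only
    rw [hχ1 x (thickening_mono (min_le_right _ _) _ hx), one_mul]
  rw [hTφ]
  refine (hC₀ φ (hφsub.trans (hsub.trans (cthickening_mono (inv_le_one_of_one_le₀ hz) _)))).trans ?_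
  have hsum : ∑ k ∈ Finset.range (N + 1), SchwartzMap.seminorm ℂ 0 k φ ≤
      ∑ k ∈ Finset.range (N + 1), (∑ i ∈ Finset.range (k + 1), (k.choose i : ℝ) * D i) *
        Real.exp 2 * ((1 + ‖z‖) ^ N * Real.exp (supportingFunction A (imPart z))) := by
    gcongr with k hk
    have hDs : 0 ≤ ∑ i ∈ Finset.range (k + 1), (k.choose i : ℝ) * D i :=
      Finset.sum_nonneg fun i _ => mul_nonneg (by positivity) (hD0 i)
    refine SchwartzMap.seminorm_le_bound ℂ 0 k φ (by positivity) fun x => ?_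
    rw [pow_zero, one_mul]
    by_cases hx : x ∈ tsupport φ
    -- The closed δ-thickening lies in the open 2δ-thickening, and 2δ|Im z| ≤ 2.
    · have hre : (fourierForm d z x).re ≤ supportingFunction A (imPart z) + 2 := by
        have hx2 : x ∈ thickening (2 * (1 + ‖z‖)⁻¹) A :=
          cthickening_subset_thickening' (by positivity) (by linarith) _ (hsub (hφsub hx))
        rw [fourierForm_apply_re]
        refine (inner_le_of_mem_thickening hA hx2 _).trans ?_
        have : (1 + ‖z‖)⁻¹ * ‖imPart z‖ ≤ 1 := by
          rw [inv_mul_le_one₀ (by positivity)]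
          linarith [norm_imPart_le z]
        linarith
      rw [hφx]
      calc _ ≤ ∑ i ∈ Finset.range (k + 1), (k.choose i : ℝ) * ‖iteratedFDeriv ℝ i χ x‖ *
            ‖iteratedFDeriv ℝ (k - i) (fun x => Complex.exp (fourierForm d z x)) x‖ :=
            norm_iteratedFDeriv_mul_le hχs (contDiff_exp_clm _) x (mod_cast le_top)
        _ ≤ ∑ i ∈ Finset.range (k + 1), (k.choose i : ℝ) * (D i * (1 + ‖z‖) ^ i) *
            ((1 + ‖z‖) ^ (k - i) * Real.exp (supportingFunction A (imPart z) + 2)) := by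
            gcongr with i hi
            · exact mul_nonneg (by positivity) (mul_nonneg (hD0 i) (by positivity))
            · exact hχb i x
            · refine (norm_iteratedFDeriv_exp_clm_le _ _ x).trans ?_
              gcongr
              linarith [norm_fourierForm_le z]
        _ = ∑ i ∈ Finset.range (k + 1), ((k.choose i : ℝ) * D i) *
            ((1 + ‖z‖) ^ k * Real.exp (supportingFunction A (imPart z) + 2)) := by
            refine Finset.sum_congr rfl fun i hi => ?_
            have : (1 + ‖z‖) ^ k = (1 + ‖z‖) ^ i * (1 + ‖z‖) ^ (k - i) := by
              rw [← pow_add, Nat.add_sub_cancel' (Nat.lt_succ_iff.1 (Finset.mem_range.1 hi))]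
            rw [this]
            ring
        _ = (∑ i ∈ Finset.range (k + 1), (k.choose i : ℝ) * D i) * Real.exp 2 *
            ((1 + ‖z‖) ^ k * Real.exp (supportingFunction A (imPart z))) := by
            rw [← Finset.sum_mul, Real.exp_add]
            ring
        _ ≤ _ := by
            gcongr
            exact Nat.lt_succ_iff.1 (Finset.mem_range.1 hk)
    · rw [image_eq_zero_of_notMem_tsupport fun hx' => hx (tsupport_iteratedFDeriv_subset k hx')]
      simp only [norm_zero]
      positivity
  calc C₀ * ∑ k ∈ Finset.range (N + 1), SchwartzMap.seminorm ℂ 0 k φ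
      ≤ |C₀| * ∑ k ∈ Finset.range (N + 1), SchwartzMap.seminorm ℂ 0 k φ := by
        gcongr
        exact le_abs_self _
    _ ≤ |C₀| * _ := mul_le_mul_of_nonneg_left hsum (abs_nonneg _)
    _ = _ := by
        rw [← Finset.sum_mul]
        ring

/-- The extension uses one cutoff for all z, to be holomorphic; the z-dependent cutoffs enter only
through the estimate. -/
theorem IsFourierTransformOf.extendsEntireWithBound {f : EuclideanSpace ℝ (Fin d) → ℂ}
    {T : 𝓢'(EuclideanSpace ℝ (Fin d), ℂ)} (hf : IsFourierTransformOf f T)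
    {A : Set (EuclideanSpace ℝ (Fin d))} (hA : IsCompact A) (hT : dsupport T ⊆ A) {N : ℕ}
    (hN : HasOrderAtMost T N) : ExtendsEntireWithBound A f N := by
  obtain ⟨χ, hχ, -, δ, hδ, hχ1⟩ := exists_schwartz_cutoff hA isOpen_univ (Set.subset_univ _)
  let G : EuclideanSpace ℂ (Fin d) → 𝓢(EuclideanSpace ℝ (Fin d), ℂ) := fun z =>
    mulSmooth χ hχ _ (contDiff_exp_clm (fourierForm d z))
  obtain ⟨C, hC⟩ := hN.exists_norm_apply_exp_le hA hT hδ G fun z x hx => by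
    rw [mulSmooth_apply, hχ1 x hx, one_mul]
  refine ⟨fun z => ((((2 * Real.pi) ^ ((d : ℝ) / 2))⁻¹ : ℝ) : ℂ) * T (G z), ?_,
    fun x => (hf.eq_apply_exp hT χ hχ hδ hχ1 x).symm,
    ‖((((2 * Real.pi) ^ ((d : ℝ) / 2))⁻¹ : ℝ) : ℂ)‖ * C, fun z => ?_⟩
  · exact (differentiable_apply_exp (T : 𝓢(EuclideanSpace ℝ (Fin d), ℂ) →L[ℂ] ℂ) (fourierForm d)
      norm_fourierForm_le χ hχ G fun z x => rfl).const_mul _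
  · rw [norm_mul, mul_assoc, mul_assoc, ← mul_assoc C]
    gcongr
    exact hC z

end Order

/-! ### Fourier inversion in this normalization. -/

section FourierInverse

variable {d : ℕ}

/-- The inverse of the Fourier transform `fourierSchwartz`. -/
noncomputable def fourierSchwartzInv (d : ℕ) :
    𝓢(EuclideanSpace ℝ (Fin d), ℂ) →L[ℂ] 𝓢(EuclideanSpace ℝ (Fin d), ℂ) :=
  (((2 * Real.pi) ^ ((d : ℝ) / 2) : ℝ) : ℂ) •
    ((FourierTransform.fourierInvCLM ℂ 𝓢(EuclideanSpace ℝ (Fin d), ℂ)).comp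
      (SchwartzMap.compCLMOfContinuousLinearEquiv ℂ
        (ContinuousLinearEquiv.smulLeft (Units.mk0 (2 * Real.pi) Real.two_pi_pos.ne'))))

theorem fourierSchwartzInv_fourierSchwartz (φ : 𝓢(EuclideanSpace ℝ (Fin d), ℂ)) :
    fourierSchwartzInv d (fourierSchwartz d φ) = φ := by
  have hc : (((2 * Real.pi) ^ ((d : ℝ) / 2) : ℝ) : ℂ) ≠ 0 :=
    Complex.ofReal_ne_zero.2 (Real.rpow_pos_of_pos Real.two_pi_pos _).ne'
  have h : SchwartzMap.compCLMOfContinuousLinearEquiv ℂ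
      (ContinuousLinearEquiv.smulLeft (Units.mk0 (2 * Real.pi) Real.two_pi_pos.ne'))
      (SchwartzMap.compCLMOfContinuousLinearEquiv ℂ
      (ContinuousLinearEquiv.smulLeft
        (Units.mk0 ((2 * Real.pi)⁻¹ : ℝ) (inv_ne_zero Real.two_pi_pos.ne'))) (𝓕 φ)) = 𝓕 φ := by
    ext x
    change (𝓕 φ) ((2 * Real.pi)⁻¹ • (2 * Real.pi) • x) = _
    rw [inv_smul_smul₀ Real.two_pi_pos.ne']
  simp only [fourierSchwartzInv, fourierSchwartz, _root_.smul_apply, map_smul,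
    ContinuousLinearMap.comp_apply, FourierTransform.fourierCLM_apply, h,
    FourierTransform.fourierInvCLM_apply, FourierTransform.fourierInv_fourier_eq]
  rw [smul_smul, Complex.ofReal_inv, inv_mul_cancel₀ hc, one_smul]

theorem fourierSchwartz_fourierSchwartzInv (φ : 𝓢(EuclideanSpace ℝ (Fin d), ℂ)) :
    fourierSchwartz d (fourierSchwartzInv d φ) = φ := by
  have hc : (((2 * Real.pi) ^ ((d : ℝ) / 2) : ℝ) : ℂ) ≠ 0 :=
    Complex.ofReal_ne_zero.2 (Real.rpow_pos_of_pos Real.two_pi_pos _).ne'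
  have h : SchwartzMap.compCLMOfContinuousLinearEquiv ℂ
      (ContinuousLinearEquiv.smulLeft
        (Units.mk0 ((2 * Real.pi)⁻¹ : ℝ) (inv_ne_zero Real.two_pi_pos.ne')))
      (SchwartzMap.compCLMOfContinuousLinearEquiv ℂ
      (ContinuousLinearEquiv.smulLeft (Units.mk0 (2 * Real.pi) Real.two_pi_pos.ne')) φ) = φ := by
    ext x
    change φ ((2 * Real.pi) • (2 * Real.pi)⁻¹ • x) = _
    rw [smul_inv_smul₀ Real.two_pi_pos.ne']
  simp only [fourierSchwartzInv, fourierSchwartz, _root_.smul_apply, map_smul,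
    ContinuousLinearMap.comp_apply, FourierTransform.fourierCLM_apply,
    FourierTransform.fourierInvCLM_apply, FourierTransform.fourier_fourierInv_eq, h]
  rw [smul_smul, Complex.ofReal_inv, mul_inv_cancel₀ hc, one_smul]

theorem exists_fourierSchwartzInv_apply (d : ℕ) :
    ∃ c : ℂ, ∀ (φ : 𝓢(EuclideanSpace ℝ (Fin d), ℂ)) (ξ : EuclideanSpace ℝ (Fin d)),
      fourierSchwartzInv d φ ξ =
        c * ∫ x : EuclideanSpace ℝ (Fin d), φ x * Complex.exp (Complex.I * (⟪ξ, x⟫ : ℝ)) := by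
  refine ⟨(((2 * Real.pi) ^ ((d : ℝ) / 2) : ℝ) : ℂ) * ((|((2 * Real.pi) ^ d)⁻¹| : ℝ) : ℂ),
    fun φ ξ => ?_⟩
  have h : fourierSchwartzInv d φ ξ = (((2 * Real.pi) ^ ((d : ℝ) / 2) : ℝ) : ℂ) *
      𝓕⁻ (SchwartzMap.compCLMOfContinuousLinearEquiv ℂ
        (ContinuousLinearEquiv.smulLeft (Units.mk0 (2 * Real.pi) Real.two_pi_pos.ne')) φ) ξ := rfl
  have h2 := Measure.integral_comp_smul volume
    (fun x : EuclideanSpace ℝ (Fin d) => φ x * Complex.exp (Complex.I * (⟪ξ, x⟫ : ℝ)))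
    (2 * Real.pi)
  rw [finrank_euclideanSpace_fin, Complex.real_smul] at h2
  rw [h, SchwartzMap.fourierInv_coe, Real.fourierInv_eq', mul_assoc, ← h2]
  congr 1
  refine integral_congr_ae (.of_forall fun x => ?_)
  change Complex.exp (((2 * Real.pi * ⟪x, ξ⟫ : ℝ) : ℂ) * Complex.I) • φ ((2 * Real.pi) • x) = _
  dsimp only
  rw [smul_eq_mul, mul_comm, inner_smul_right, real_inner_comm, mul_comm Complex.I]

end FourierInverse

/-! ### Functions of polynomial growth as Fourier transforms. -/

section Growth

variable {d : ℕ}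

theorem integrable_inv_one_add_norm_pow (d : ℕ) :
    Integrable fun x : EuclideanSpace ℝ (Fin d) => ((1 + ‖x‖) ^ (d + 1))⁻¹ := by
  have h := integrable_one_add_norm (E := EuclideanSpace ℝ (Fin d)) (μ := volume)
    (r := ((d + 1 : ℕ) : ℝ)) (by rw [finrank_euclideanSpace_fin]; exact_mod_cast Nat.lt_succ_self d)
  refine h.congr (.of_forall fun x => ?_)
  dsimp only
  rw [Real.rpow_neg (by positivity), Real.rpow_natCast]

theorem pow_mul_norm_le_sup_seminorm {E : Type*} [NormedAddCommGroup E] [NormedSpace ℝ E]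
    (m : ℕ) (φ : 𝓢(E, ℂ)) (x : E) : (1 + ‖x‖) ^ m * ‖φ x‖ ≤
      2 ^ m * (Finset.Iic (m, 0)).sup (schwartzSeminormFamily ℂ E ℂ) φ := by
  have := SchwartzMap.one_add_le_sup_seminorm_apply (𝕜 := ℂ) (m := (m, 0)) le_rfl le_rfl φ x
  rwa [norm_iteratedFDeriv_zero] at this

theorem norm_mul_schwartz_le {f : EuclideanSpace ℝ (Fin d) → ℂ} {C : ℝ} {N : ℕ} (hC : 0 ≤ C)
    (hf : ∀ x, ‖f x‖ ≤ C * (1 + ‖x‖) ^ N) {B : ℝ} {u : ℂ} {x : EuclideanSpace ℝ (Fin d)}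
    (hu : (1 + ‖x‖) ^ (N + (d + 1)) * ‖u‖ ≤ B) :
    ‖f x * u‖ ≤ C * B * ((1 + ‖x‖) ^ (d + 1))⁻¹ := by
  have h1 : (0 : ℝ) < (1 + ‖x‖) ^ (d + 1) := by positivity
  rw [← div_eq_mul_inv, le_div_iff₀ h1, norm_mul]
  calc ‖f x‖ * ‖u‖ * (1 + ‖x‖) ^ (d + 1)
      ≤ C * (1 + ‖x‖) ^ N * ‖u‖ * (1 + ‖x‖) ^ (d + 1) := by gcongr; exact hf x
    _ = C * ((1 + ‖x‖) ^ (N + (d + 1)) * ‖u‖) := by rw [pow_add]; ring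
    _ ≤ C * B := by gcongr

/-- A continuous function of polynomial growth is the Fourier transform of a tempered
distribution. -/
theorem exists_isFourierTransformOf {f : EuclideanSpace ℝ (Fin d) → ℂ} (hfc : Continuous f)
    {C : ℝ} {N : ℕ} (hf : ∀ x, ‖f x‖ ≤ C * (1 + ‖x‖) ^ N) :
    ∃ T : 𝓢'(EuclideanSpace ℝ (Fin d), ℂ), IsFourierTransformOf f T := by
  have hC : 0 ≤ C := by simpa using (norm_nonneg _).trans (hf 0)
  set q := (Finset.Iic (N + (d + 1), 0)).sup
    (schwartzSeminormFamily ℂ (EuclideanSpace ℝ (Fin d)) ℂ) with hq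
  have hb : ∀ (φ : 𝓢(EuclideanSpace ℝ (Fin d), ℂ)) x, ‖f x * φ x‖ ≤
      C * (2 ^ (N + (d + 1)) * q φ) * ((1 + ‖x‖) ^ (d + 1))⁻¹ := fun φ x =>
    norm_mul_schwartz_le hC hf (pow_mul_norm_le_sup_seminorm _ φ x)
  have hi : ∀ φ : 𝓢(EuclideanSpace ℝ (Fin d), ℂ), Integrable fun x => f x * φ x := fun φ =>
    ((integrable_inv_one_add_norm_pow d).const_mul _).mono'
      (hfc.mul φ.continuous).aestronglyMeasurable (.of_forall (hb φ))
  set I := ∫ x : EuclideanSpace ℝ (Fin d), ((1 + ‖x‖) ^ (d + 1))⁻¹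
  have hI : 0 ≤ I := integral_nonneg fun x => by positivity
  let S : 𝓢(EuclideanSpace ℝ (Fin d), ℂ) →L[ℂ] ℂ :=
    SchwartzMap.mkCLMtoNormedSpace (σ := RingHom.id ℂ) (fun φ => ∫ x, f x * φ x)
      (fun φ ψ => by
        rw [← integral_add (hi φ) (hi ψ)]
        simp [mul_add])
      (fun c φ => by
        rw [RingHom.id_apply, smul_eq_mul, ← integral_const_mul]
        simp [mul_left_comm])
      ⟨Finset.Iic (N + (d + 1), 0), C * 2 ^ (N + (d + 1)) * I, by positivity, fun φ => by
        refine (norm_integral_le_of_norm_le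
          ((integrable_inv_one_add_norm_pow d).const_mul _) (.of_forall (hb φ))).trans_eq ?_
        rw [integral_const_mul]
        ring⟩
  refine ⟨ContinuousLinearMap.toPointwiseConvergenceCLM _ _ _ _ (S.comp (fourierSchwartzInv d)),
    hfc, fun φ => ⟨hi φ, ?_⟩⟩
  rw [fourierTempered_apply]
  change S (fourierSchwartzInv d (fourierSchwartz d φ)) = _
  rw [fourierSchwartzInv_fourierSchwartz]
  rfl

end Growth

/-! ### Holomorphic parameter integrals and contour shifts. -/

section ContourShift

open Filter Topology

/-- Cauchy's estimate on unit circles dominates the derivative by the bound for the function, so no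
hypothesis on derivatives is needed. -/
theorem differentiable_integral_of_locally_dominated {E : Type*} [NormedAddCommGroup E]
    [MeasurableSpace E] [BorelSpace E] [SecondCountableTopology E] {μ : Measure E} {W : E → ℂ → ℂ}
    (hc : Continuous (Function.uncurry W)) (hd : ∀ x, Differentiable ℂ (W x))
    (hb : ∀ R : ℝ, ∃ b : E → ℝ, Integrable b μ ∧ ∀ x w, ‖w‖ ≤ R → ‖W x w‖ ≤ b x) :
    Differentiable ℂ fun w => ∫ x, W x w ∂μ := by
  intro w₀
  -- One unit for the ball around w₀, one for the Cauchy circle.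
  obtain ⟨b, hbi, hbW⟩ := hb (‖w₀‖ + 2)
  have hW : ∀ w, Continuous fun x => W x w := fun w => hc.comp (by fun_prop : Continuous (·, w))
  refine (hasDerivAt_integral_of_dominated_loc_of_deriv_le (F := fun w x => W x w)
    (F' := fun w x => deriv (W x) w) (bound := b)
    (Metric.ball_mem_nhds w₀ one_pos) ?_ ?_ ?_ ?_ hbi ?_).2.differentiableAt
  · exact .of_forall fun w => (hW w).aestronglyMeasurable
  · exact hbi.mono' (hW w₀).aestronglyMeasurable (.of_forall fun x => hbW x w₀ (by linarith))
  · exact ((measurable_deriv_with_param hc).comp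
      (measurable_id.prodMk measurable_const)).aestronglyMeasurable
  · refine .of_forall fun x w hw => ?_
    have := Complex.norm_deriv_le_of_forall_mem_sphere_norm_le (c := w) (R := 1) (C := b x)
      one_pos (hd x).diffContOnCl fun z hz => hbW x z ?_
    · simpa using this
    · rw [Metric.mem_ball, dist_eq_norm] at hw
      rw [mem_sphere_iff_norm] at hz
      have h1 : z = w₀ + (w - w₀) + (z - w) := by ring
      rw [h1]
      refine (norm_add₃_le).trans ?_
      linarith
  · exact .of_forall fun x w _ => (hd x w).hasDerivAt

/-- Shifting the contour of integration: if `W x (w + s) = W (x + s v) w` for real `s`, then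
`∫ W x w dx` does not depend on `w`. -/
theorem integral_eq_of_translation_invariant {E : Type*} [NormedAddCommGroup E]
    [NormedSpace ℝ E] [MeasurableSpace E] [BorelSpace E] [SecondCountableTopology E]
    {μ : Measure E} [μ.IsAddRightInvariant] {W : E → ℂ → ℂ}
    (hc : Continuous (Function.uncurry W)) (hd : ∀ x, Differentiable ℂ (W x))
    (hb : ∀ R : ℝ, ∃ b : E → ℝ, Integrable b μ ∧ ∀ x w, ‖w‖ ≤ R → ‖W x w‖ ≤ b x) (v : E)
    (hv : ∀ x w (s : ℝ), W x (w + s) = W (x + s • v) w) (w w' : ℂ) :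
    ∫ x, W x w ∂μ = ∫ x, W x w' ∂μ := by
  have hJ := differentiable_integral_of_locally_dominated (μ := μ) hc hd hb
  refine is_const_of_deriv_eq_zero hJ (fun w => ?_) w w'
  have h1 : HasDerivAt (fun s : ℝ => ∫ x, W x (w + s) ∂μ) (deriv (fun w => ∫ x, W x w ∂μ) w) 0 := by
    have h2 : HasDerivAt (fun z : ℂ => ∫ x, W x (w + z) ∂μ)
        (deriv (fun w => ∫ x, W x w ∂μ) w) ((0 : ℝ) : ℂ) := by
      refine HasDerivAt.comp_const_add (f := fun w => ∫ x, W x w ∂μ) w ((0 : ℝ) : ℂ) ?_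
      simpa using (hJ w).hasDerivAt
    exact h2.comp_ofReal
  -- Translation invariance makes the integral constant along real shifts; being holomorphic, it
  -- then has zero complex derivative.
  have h3 : (fun s : ℝ => ∫ x, W x (w + s) ∂μ) = fun _ => ∫ x, W x w ∂μ := by
    ext1 s
    simp_rw [hv]
    exact integral_add_right_eq_self (fun x => W x w) (s • v)
  rw [h3] at h1
  exact h1.unique (hasDerivAt_const _ _)

end ContourShift

/-! ### Support of the distribution by contour shift. -/

section Support

open scoped ContDiff
open Metric Distribution Filter Topology

variable {d : ℕ}

theorem continuous_realToComplex : Continuous (realToComplex (d := d)) := by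
  unfold realToComplex
  fun_prop

theorem realToComplex_add_smul (x v : EuclideanSpace ℝ (Fin d)) (s : ℝ) :
    realToComplex (x + s • v) = realToComplex x + (s : ℂ) • realToComplex v := by
  ext j
  simp [realToComplex]

theorem imPart_realToComplex_add_smul (x v : EuclideanSpace ℝ (Fin d)) (w : ℂ) :
    imPart (realToComplex x + w • realToComplex v) = w.im • v := by
  ext j
  simp [realToComplex, imPart]

theorem norm_realToComplex_add_smul_le (x v : EuclideanSpace ℝ (Fin d)) (w : ℂ) :
    1 + ‖realToComplex x + w • realToComplex v‖ ≤ (1 + ‖x‖) * (1 + ‖w‖ * ‖v‖) := by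
  have h := norm_add_le (realToComplex x) (w • realToComplex v)
  rw [norm_smul, norm_realToComplex, norm_realToComplex] at h
  nlinarith [norm_nonneg x, mul_nonneg (norm_nonneg w) (norm_nonneg v)]

/-- The inverse Fourier transform of a compactly supported smooth function extends to an entire
function, with rapid decay along each complex line. -/
theorem exists_entire_fourierSchwartzInv (φ : 𝓢(EuclideanSpace ℝ (Fin d), ℂ))
    (hφ : HasCompactSupport φ) (m : ℕ) :
    ∃ H : EuclideanSpace ℂ (Fin d) → ℂ, Differentiable ℂ H ∧
      (∀ x, H (realToComplex x) = fourierSchwartzInv d φ x) ∧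
      ∃ (C : ℝ) (M : ℕ), 0 ≤ C ∧ ∀ x v (w : ℂ) (S : ℝ), (∀ y ∈ tsupport φ, -(w.im * ⟪y, v⟫) ≤ S) →
        (1 + ‖x‖) ^ m * ‖H (realToComplex x + w • realToComplex v)‖ ≤
          C * ((1 + ‖w‖ * ‖v‖) ^ M * Real.exp S) := by
  obtain ⟨c, hc⟩ := exists_fourierSchwartzInv_apply d
  let G : EuclideanSpace ℂ (Fin d) → 𝓢(EuclideanSpace ℝ (Fin d), ℂ) := fun z =>
    mulSmooth φ hφ _ (contDiff_exp_clm (fourierForm d (-z)))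
  let H : EuclideanSpace ℂ (Fin d) → ℂ := fun z => c * SchwartzMap.integralCLM ℂ volume (G z)
  -- For fixed w and v, H(x + wv) is the inverse transform in x of the Schwartz function φ(y) e^{iw
  -- v·y}, so decay in x follows from continuity of ℱ⁻¹.
  have hH : ∀ x v (w : ℂ), H (realToComplex x + w • realToComplex v) =
      fourierSchwartzInv d (G (w • realToComplex v)) x := by
    intro x v w
    rw [hc]
    simp only [H, SchwartzMap.integralCLM_apply]
    congr 1
    refine integral_congr_ae (.of_forall fun y => ?_)
    simp only [G, mulSmooth_apply]
    rw [neg_add_rev, map_add, map_neg _ (realToComplex x), _root_.add_apply, _root_.neg_apply,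
      fourierForm_realToComplex, Complex.exp_add, neg_mul, neg_neg, mul_assoc]
  refine ⟨H, ?_, fun x => ?_, ?_⟩
  · refine (differentiable_apply_exp (SchwartzMap.integralCLM ℂ volume) (-fourierForm d)
      (fun z => ?_) φ hφ G fun z x => ?_).const_mul c
    · rw [LinearMap.neg_apply, norm_neg]
      exact norm_fourierForm_le z
    · simp only [G, mulSmooth_apply, map_neg, LinearMap.neg_apply]
  · have := hH x 0 0
    rw [zero_smul, add_zero] at this
    rw [this]
    congr 2
    ext y
    simp [G, mulSmooth_apply]
  · let q : Seminorm ℂ 𝓢(EuclideanSpace ℝ (Fin d), ℂ) :=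
      ((Finset.Iic (m, 0)).sup (schwartzSeminormFamily ℂ (EuclideanSpace ℝ (Fin d)) ℂ)).comp
        (fourierSchwartzInv d).toLinearMap
    have hq : Continuous q :=
      (Seminorm.continuous_finsetSup fun i _ =>
        (schwartz_withSeminorms ℂ (EuclideanSpace ℝ (Fin d)) ℂ).continuous_seminorm i).comp
        (fourierSchwartzInv d).continuous
    obtain ⟨C, M, hC, hCM⟩ := exists_continuous_seminorm_mul_le q hq φ
    refine ⟨2 ^ m * C, M, by positivity, fun x v w S hS => ?_⟩
    rw [hH, mul_assoc]
    refine (pow_mul_norm_le_sup_seminorm m _ x).trans ?_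
    gcongr
    refine hCM _ _ (contDiff_exp_clm _) (by positivity) (fun y hy j hj => ?_) (G _) fun y => rfl
    have h1 : 1 ≤ 1 + ‖w‖ * ‖v‖ := le_add_of_nonneg_right (by positivity)
    refine (norm_iteratedFDeriv_exp_clm_le _ j y).trans ?_
    refine le_trans ?_ (le_mul_of_one_le_right (by positivity)
      (le_add_of_nonneg_right (norm_nonneg y)))
    have h2 : ‖fourierForm d (-(w • realToComplex v))‖ ≤ 1 + ‖w‖ * ‖v‖ := by
      refine (norm_fourierForm_le _).trans ?_
      rw [norm_neg, norm_smul, norm_realToComplex]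
      linarith
    have h3 : (fourierForm d (-(w • realToComplex v)) y).re ≤ S := by
      refine le_trans (le_of_eq ?_) (hS y hy)
      have := imPart_realToComplex_add_smul 0 v (-w)
      rw [show realToComplex (0 : EuclideanSpace ℝ (Fin d)) = 0 by ext; simp [realToComplex],
        zero_add, neg_smul] at this
      rw [fourierForm_apply_re, this, inner_smul_right, Complex.neg_im, neg_mul]
    gcongr
    calc _ ≤ (1 + ‖w‖ * ‖v‖) ^ j := by gcongr
      _ ≤ _ := pow_le_pow_right₀ h1 hj

theorem supportingFunction_smul_le {A : Set (EuclideanSpace ℝ (Fin d))} (hA : IsCompact A)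
    (hA0 : A.Nonempty) {t : ℝ} (ht : 0 ≤ t) (y : EuclideanSpace ℝ (Fin d)) :
    supportingFunction A (t • y) ≤ t * supportingFunction A y := by
  refine csSup_le (hA0.image _) ?_
  rintro _ ⟨a, ha, rfl⟩
  dsimp only
  rw [inner_smul_right]
  exact mul_le_mul_of_nonneg_left (inner_le_supportingFunction hA ha y) ht

theorem exists_supportingFunction_le {A : Set (EuclideanSpace ℝ (Fin d))} (hA : IsCompact A)
    (hA0 : A.Nonempty) : ∃ R : ℝ, 0 ≤ R ∧ ∀ y, supportingFunction A y ≤ R * ‖y‖ := by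
  obtain ⟨R, hR⟩ := hA.isBounded.exists_norm_le
  obtain ⟨a₀, ha₀⟩ := hA0
  refine ⟨R, (norm_nonneg _).trans (hR a₀ ha₀), fun y => csSup_le ⟨_, a₀, ha₀, rfl⟩ ?_⟩
  rintro _ ⟨a, ha, rfl⟩
  refine (real_inner_le_norm _ _).trans ?_
  gcongr
  exact hR a ha

theorem tendsto_one_add_mul_pow_mul_exp_neg {a ε : ℝ} (ha : 0 ≤ a) (hε : 0 < ε) (L : ℕ) (K : ℝ) :
    Tendsto (fun t : ℝ => K * ((1 + t * a) ^ L * Real.exp (-(t * ε)))) atTop (𝓝 0) := by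
  rw [← mul_zero K]
  refine Tendsto.const_mul K ?_
  have h := ((isLittleO_pow_exp_pos_mul_atTop L hε).tendsto_div_nhds_zero).const_mul ((1 + a) ^ L)
  rw [mul_zero] at h
  refine squeeze_zero' ?_ ?_ h
  · filter_upwards [eventually_ge_atTop 0] with t ht
    positivity
  · filter_upwards [eventually_ge_atTop 1] with t ht
    rw [Real.exp_neg, ← div_eq_mul_inv, ← mul_div_assoc, ← mul_pow, mul_comm ε t]
    gcongr
    nlinarith

/-- Vanishing of the pairing of `F` with a test function supported in a half-space disjoint
from `A`. -/
theorem integral_mul_fourierSchwartzInv_eq_zero {A : Set (EuclideanSpace ℝ (Fin d))}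
    (hA : IsCompact A) (hA0 : A.Nonempty) {F : EuclideanSpace ℂ (Fin d) → ℂ}
    (hF : Differentiable ℂ F) {C : ℝ} {N : ℕ} (hFb : ∀ z, ‖F z‖ ≤
      C * (1 + ‖z‖) ^ N * Real.exp (supportingFunction A (imPart z)))
    (φ : 𝓢(EuclideanSpace ℝ (Fin d), ℂ)) (hφ : HasCompactSupport φ)
    (v : EuclideanSpace ℝ (Fin d)) {ε : ℝ} (hε : 0 < ε)
    (hφv : ∀ y ∈ tsupport φ, supportingFunction A v + ε ≤ ⟪y, v⟫) :
    ∫ x, F (realToComplex x) * fourierSchwartzInv d φ x = 0 := by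
  -- N powers of decay absorb the growth of F; the other d + 1 make the product integrable.
  obtain ⟨H, hH, hHx, D, M, hD, hHb⟩ := exists_entire_fourierSchwartzInv φ hφ (N + (d + 1))
  have hC : 0 ≤ C := by
    have h := (norm_nonneg _).trans (hFb 0)
    rw [norm_zero, add_zero, one_pow, mul_one] at h
    exact nonneg_of_mul_nonneg_left h (Real.exp_pos _)
  set W : EuclideanSpace ℝ (Fin d) → ℂ → ℂ := fun x w =>
    F (realToComplex x + w • realToComplex v) * H (realToComplex x + w • realToComplex v) with hW
  have hWb : ∀ x (w : ℂ) (S : ℝ), (∀ y ∈ tsupport φ, -(w.im * ⟪y, v⟫) ≤ S) →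
      ‖W x w‖ ≤ C * D * ((1 + ‖w‖ * ‖v‖) ^ (N + M) *
        Real.exp (supportingFunction A (w.im • v) + S)) * ((1 + ‖x‖) ^ (d + 1))⁻¹ := by
    intro x w S hS
    have h1 : (0 : ℝ) < (1 + ‖x‖) ^ (d + 1) := by positivity
    have h2 := hFb (realToComplex x + w • realToComplex v)
    rw [imPart_realToComplex_add_smul] at h2
    have h3 := hHb x v w S hS
    rw [← div_eq_mul_inv, le_div_iff₀ h1, norm_mul]
    calc _ ≤ C * ((1 + ‖x‖) * (1 + ‖w‖ * ‖v‖)) ^ N * Real.exp (supportingFunction A (w.im • v)) *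
          ‖H (realToComplex x + w • realToComplex v)‖ * (1 + ‖x‖) ^ (d + 1) := by
          gcongr
          refine h2.trans ?_
          gcongr
          exact norm_realToComplex_add_smul_le x v w
      _ = C * (1 + ‖w‖ * ‖v‖) ^ N * Real.exp (supportingFunction A (w.im • v)) *
          ((1 + ‖x‖) ^ (N + (d + 1)) * ‖H (realToComplex x + w • realToComplex v)‖) := by
          rw [mul_pow, pow_add (1 + ‖x‖)]
          ring
      _ ≤ C * (1 + ‖w‖ * ‖v‖) ^ N * Real.exp (supportingFunction A (w.im • v)) *
          (D * ((1 + ‖w‖ * ‖v‖) ^ M * Real.exp S)) := by gcongr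
      _ = _ := by
          rw [pow_add, Real.exp_add]
          ring
  have hp : Continuous fun p : EuclideanSpace ℝ (Fin d) × ℂ =>
      realToComplex p.1 + p.2 • realToComplex v :=
    (continuous_realToComplex.comp continuous_fst).add (continuous_snd.smul continuous_const)
  have hWc : Continuous (Function.uncurry W) :=
    (hF.continuous.comp hp).mul (hH.continuous.comp hp)
  have hWd : ∀ x, Differentiable ℂ (W x) := fun x => by
    have hl : Differentiable ℂ fun w : ℂ => realToComplex x + w • realToComplex v := by fun_prop
    exact (hF.comp hl).mul (hH.comp hl)
  obtain ⟨ρ, hρ0, hρ⟩ : ∃ ρ : ℝ, 0 ≤ ρ ∧ ∀ y ∈ tsupport φ, ‖y‖ ≤ ρ := by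
    obtain ⟨R, hR⟩ := hφ.isBounded.exists_norm_le
    exact ⟨max 0 R, le_max_left _ _, fun x hx => (hR x hx).trans (le_max_right _ _)⟩
  obtain ⟨r, hr0, hr⟩ := exists_supportingFunction_le hA hA0
  have hWdom : ∀ R : ℝ, ∃ b : EuclideanSpace ℝ (Fin d) → ℝ, Integrable b ∧
      ∀ x w, ‖w‖ ≤ R → ‖W x w‖ ≤ b x := by
    intro R
    refine ⟨_, (integrable_inv_one_add_norm_pow d).const_mul (C * D * ((1 + R * ‖v‖) ^ (N + M) *
      Real.exp (r * (R * ‖v‖) + R * (ρ * ‖v‖)))), fun x w hw => ?_⟩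
    have hR : 0 ≤ R := (norm_nonneg w).trans hw
    have him : |w.im| ≤ R := (Complex.abs_im_le_norm w).trans hw
    refine (hWb x w (R * (ρ * ‖v‖)) fun y hy => ?_).trans ?_
    · calc -(w.im * ⟪y, v⟫) ≤ |w.im * ⟪y, v⟫| := neg_le_abs _
        _ = |w.im| * |⟪y, v⟫| := abs_mul _ _
        _ ≤ R * (ρ * ‖v‖) := by
          gcongr
          refine (abs_real_inner_le_norm _ _).trans ?_
          gcongr
          exact hρ y hy
    · gcongr
      refine (hr _).trans ?_
      rw [norm_smul, Real.norm_eq_abs]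
      gcongr
  have hshift := integral_eq_of_translation_invariant (μ := volume) hWc hWd hWdom v
    (fun x w s => by
      simp only [hW]
      rw [realToComplex_add_smul, add_smul, add_assoc, add_comm (w • _)])
  have hW0 : ∀ x, W x 0 = F (realToComplex x) * fourierSchwartzInv d φ x := fun x => by
    simp only [hW, zero_smul, add_zero, hHx]
  simp_rw [← hW0]
  set K := ∫ x : EuclideanSpace ℝ (Fin d), ((1 + ‖x‖) ^ (d + 1))⁻¹
  have hlim := tendsto_one_add_mul_pow_mul_exp_neg (norm_nonneg v) hε (N + M) (C * D * K)
  refine norm_le_zero_iff.1 (ge_of_tendsto hlim ?_)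
  filter_upwards [eventually_ge_atTop 0] with t ht
  -- At w = it the exponents tH_A(v) and -t(H_A(v) + ε) add up to -tε, which beats the powers of t.
  rw [hshift 0 (t * Complex.I)]
  have him : ((t : ℂ) * Complex.I).im = t := by simp
  have hn : ‖(t : ℂ) * Complex.I‖ = t := by simp [abs_of_nonneg ht]
  refine (norm_integral_le_of_norm_le ((integrable_inv_one_add_norm_pow d).const_mul
    (C * D * ((1 + t * ‖v‖) ^ (N + M) * Real.exp (-(t * ε))))) (.of_forall fun x => ?_)).trans_eq ?_
  · refine (hWb x (t * Complex.I) (-(t * (supportingFunction A v + ε))) fun y hy => ?_).trans ?_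
    · rw [him]
      have := mul_le_mul_of_nonneg_left (hφv y hy) ht
      linarith
    · rw [him, hn]
      gcongr
      have := supportingFunction_smul_le hA hA0 ht v
      linarith
  · rw [integral_const_mul]
    ring

/-- If `f` extends to an entire function with the exponential bound given by `A`, then the
distribution with Fourier transform `f` is supported in `A`. -/
theorem IsFourierTransformOf.dsupport_subset {f : EuclideanSpace ℝ (Fin d) → ℂ}
    {T : 𝓢'(EuclideanSpace ℝ (Fin d), ℂ)} (hf : IsFourierTransformOf f T)
    {A : Set (EuclideanSpace ℝ (Fin d))} (hA0 : A.Nonempty) (hA : IsCompact A)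
    (hAc : Convex ℝ A) {N : ℕ} (hE : ExtendsEntireWithBound A f N) : dsupport T ⊆ A := by
  obtain ⟨F, hF, hFx, C, hFb⟩ := hE
  intro x₀ hx₀
  by_contra hxA
  refine (notMem_dsupport_iff (f := T) x₀).2 ?_ hx₀
  obtain ⟨l, u, hlA, hlx⟩ := geometric_hahn_banach_closed_point hAc hA.isClosed hxA
  set v := (InnerProductSpace.toDual ℝ (EuclideanSpace ℝ (Fin d))).symm l with hv
  have hlv : ∀ y, l y = ⟪y, v⟫ := fun y => by
    rw [real_inner_comm, hv, InnerProductSpace.toDual_symm_apply]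
  have hAv : supportingFunction A v ≤ u := by
    refine csSup_le (hA0.image _) ?_
    rintro _ ⟨a, ha, rfl⟩
    exact (hlv a).symm.trans_le (hlA a ha).le
  -- The half-space bounded by the midway hyperplane leaves the gap ε = (l x₀ - u)/2; the ball
  -- forces compact support.
  refine ⟨{y | (u + l x₀) / 2 < l y} ∩ ball x₀ 1, fun φ hφ => ?_,
    (isOpen_lt continuous_const l.continuous).inter isOpen_ball,
    ⟨by simp only [Set.mem_ofPred_eq]; linarith, mem_ball_self one_pos⟩⟩
  have hφc : HasCompactSupport φ := (isCompact_closedBall x₀ 1).of_isClosed_subset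
    (isClosed_tsupport _) fun y hy => ball_subset_closedBall (hφ hy).2
  have h0 := integral_mul_fourierSchwartzInv_eq_zero hA hA0 hF hFb φ hφc v
    (ε := (l x₀ - u) / 2) (by linarith) fun y hy => by
      have : (u + l x₀) / 2 < l y := (hφ hy).1
      rw [← hlv y]
      linarith
  simp_rw [hFx] at h0
  rw [← (hf.2 _).2, fourierTempered_apply, fourierSchwartz_fourierSchwartzInv] at h0
  exact h0

end Support

/-! ### Assembly of the equivalence. -/

section Main

variable {d : ℕ}

theorem ExtendsEntireWithBound.exists_isFourierTransformOf {f : EuclideanSpace ℝ (Fin d) → ℂ}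
    {A : Set (EuclideanSpace ℝ (Fin d))} (hA0 : A.Nonempty) {N : ℕ}
    (hE : ExtendsEntireWithBound A f N) :
    ∃ T : 𝓢'(EuclideanSpace ℝ (Fin d), ℂ), IsFourierTransformOf f T := by
  obtain ⟨F, hF, hFx, C, hFb⟩ := hE
  have hfc : Continuous f := by
    rw [← funext hFx]
    exact hF.continuous.comp continuous_realToComplex
  refine ComplexPaleyWiener.exists_isFourierTransformOf hfc (C := C) (N := N) fun x => ?_
  have h := hFb (realToComplex x)
  have him : imPart (realToComplex x) = 0 := by
    ext j
    simp [imPart, realToComplex]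
  have hs : supportingFunction A 0 = 0 := by
    simp [supportingFunction, hA0.image_const]
  rwa [hFx, norm_realToComplex, him, hs, Real.exp_zero, mul_one] at h

theorem exists_hasOrder (T : 𝓢'(EuclideanSpace ℝ (Fin d), ℂ)) : ∃ N, HasOrder T N :=
  have h : {n : ℕ | HasOrderAtMost T n}.Nonempty := exists_hasOrderAtMost T
  ⟨sInf {n : ℕ | HasOrderAtMost T n}, Nat.sInf_mem h, fun _ hn => Nat.sInf_le hn⟩

end Main

end ComplexPaleyWiener

theorem mainTheorem11 (d : ℕ) (A : Set (EuclideanSpace ℝ (Fin d)))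
    (hA_nonempty : A.Nonempty) (hA_compact : IsCompact A) (hA_convex : Convex ℝ A)
    (hA_symm : ∀ a ∈ A, -a ∈ A) (f : EuclideanSpace ℝ (Fin d) → ℂ) :
    ((∃ T : 𝓢'(EuclideanSpace ℝ (Fin d), ℂ),
        Distribution.dsupport T ⊆ A ∧ ComplexPaleyWiener.IsFourierTransformOf f T) ↔
      ∃ N : ℕ, ComplexPaleyWiener.ExtendsEntireWithBound A f N) ∧
    ((∃ N : ℕ, ComplexPaleyWiener.ExtendsEntireWithBound A f N) →
      ∀ T : 𝓢'(EuclideanSpace ℝ (Fin d), ℂ), ComplexPaleyWiener.IsFourierTransformOf f T →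
        ∃ N : ℕ, ComplexPaleyWiener.HasOrder T N ∧
          ComplexPaleyWiener.ExtendsEntireWithBound A f N) := by
  refine ⟨⟨?_, ?_⟩, ?_⟩
  · rintro ⟨T, hT, hf⟩
    obtain ⟨N, hN⟩ := ComplexPaleyWiener.exists_hasOrderAtMost T
    exact ⟨N, hf.extendsEntireWithBound hA_compact hT hN⟩
  · rintro ⟨N, hN⟩
    obtain ⟨T, hf⟩ := hN.exists_isFourierTransformOf hA_nonempty
    exact ⟨T, hf.dsupport_subset hA_nonempty hA_compact hA_convex hN, hf⟩
  · rintro ⟨M, hM⟩ T hf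
    obtain ⟨N, hN⟩ := ComplexPaleyWiener.exists_hasOrder T
    exact ⟨N, hN, hf.extendsEntireWithBound hA_compact
      (hf.dsupport_subset hA_nonempty hA_compact hA_convex hM) hN.1⟩
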